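/- Let $s(2)=e$ and $s(m)=m(\log m)^2$ for $m\ge 3$. For an integer $n\ge 2$ and $x>0$ put $w_n(x)=1-\frac nx-\frac{n-1}{\log n}\cdot\frac{\log x}{x}$, and let $$\kappa_m=\frac1m\sum_{\substack{p\le \frac{m+1}{2}\\ p\ \mathrm{prime}}}\ \min_{0\le j\le m}\left\{\left\lfloor\frac jp\right\rfloor+\left\lfloor\frac{m-j}p\right\rfloor\right\}\frac{\log p}{p-1}\,w_p\!\left(s(m)e^{s(m)}\right).$$ For $m\ge5$ let $$d=d(m)=\left(m+\tfrac12\right)\log m-(1+\kappa_m)m-0.02394,$$ $$B=B(m)=m^2\log m-(1+\kappa_m)m^2+(m+1)\log(m+1)+\tfrac12m\log m-(1.02394+\kappa_m)m+0.0000525,$$ $$D=D(m)=(m+1)\log(m+1)-\kappa_mm+0.0000525+\frac{m}{e^{s(m)}},$$ and for small $m$ let $d(2)=0.3654$, $d(3)=0.5139$, $d(4)=1.6016$; $B(2)=2.4099$, $B(3)=3.6433$, $B(4)=9.7676$; $D(2)=3.8111$, $D(3)=5.1819$, $D(4)=7.3631$. Put $$\widehat B=\left(1+\frac{\log s(m)}{s(m)}\right)\left(1-\frac{d}{s(m)}\right)^{-1}B.$$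 Let $\mathbb I\subset\mathbb C$ be an imaginary quadratic field with ring of integers $\mathbb Z_{\mathbb I}$. Let $m\ge2$ be an integer and $H>0$ a real number with $\log H\ge s(m)e^{s(m)}$. Then for every $(\lambda_0,\lambda_1,\ldots,\lambda_m)\in\mathbb Z_{\mathbb I}^{m+1}\setminus\{0\}$ with $\max_{1\le j\le m}|\lambda_j|\le H$, $$\left|\lambda_0+\lambda_1e+\cdots+\lambda_me^m\right|\ \ge\ \frac{1}{2e^{D}}\left(\frac{s(m)-d}{s(m)+\log s(m)}\cdot\frac{\log\log(2H)}{\log(2H)}\right)^{m}(2H)^{-m-\frac{\widehat B}{\log\log(2H)}}.$$ -/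

import Mathlib

noncomputable section

namespace ExpMeasure

/-- `s(2) = e` and `s(m) = m (log m)^2` for `m ≥ 3`. -/
def s (m : ℕ) : ℝ :=
  if m = 2 then Real.exp 1 else (m : ℝ) * Real.log m ^ 2

/-- `w_n(x) = 1 - n / x - ((n - 1) / log n) * (log x / x)`, used for `n ≥ 2` and `x > 0`. -/
def w (n : ℕ) (x : ℝ) : ℝ :=
  1 - (n : ℝ) / x - ((n : ℝ) - 1) / Real.log n * (Real.log x / x)

/-- The minimum over `0 ≤ j ≤ m` of `⌊j / p⌋ + ⌊(m - j) / p⌋` (division of natural numbers). -/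
def minFloor (m p : ℕ) : ℕ :=
  (Finset.range (m + 1)).inf' ⟨0, Finset.mem_range.2 (Nat.succ_pos m)⟩
    (fun j => j / p + (m - j) / p)

/-- `κ_m`, where the sum runs over the primes `p ≤ (m + 1) / 2`. -/
def kappa (m : ℕ) : ℝ :=
  (1 / (m : ℝ)) *
    ∑ p ∈ (Finset.range (m + 1)).filter (fun p => p.Prime ∧ 2 * p ≤ m + 1),
      (minFloor m p : ℝ) * (Real.log p / ((p : ℝ) - 1)) * w p (s m * Real.exp (s m))

/-- `d(m)`, for `m ≥ 2`. -/
def d (m : ℕ) : ℝ :=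
  if m = 2 then 0.3654
  else if m = 3 then 0.5139
  else if m = 4 then 1.6016
  else ((m : ℝ) + 1 / 2) * Real.log m - (1 + kappa m) * m - 0.02394

/-- `B(m)`, for `m ≥ 2`. -/
def B (m : ℕ) : ℝ :=
  if m = 2 then 2.4099
  else if m = 3 then 3.6433
  else if m = 4 then 9.7676
  else (m : ℝ) ^ 2 * Real.log m - (1 + kappa m) * (m : ℝ) ^ 2
    + ((m : ℝ) + 1) * Real.log ((m : ℝ) + 1)
    + 1 / 2 * (m : ℝ) * Real.log m - (1.02394 + kappa m) * m + 0.0000525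

/-- `D(m)`, for `m ≥ 2`. -/
def D (m : ℕ) : ℝ :=
  if m = 2 then 3.8111
  else if m = 3 then 5.1819
  else if m = 4 then 7.3631
  else ((m : ℝ) + 1) * Real.log ((m : ℝ) + 1) - kappa m * m + 0.0000525
    + (m : ℝ) / Real.exp (s m)

/-- `B̂(m) = (1 + log s(m) / s(m)) (1 - d(m) / s(m))⁻¹ B(m)`. -/
def Bhat (m : ℕ) : ℝ :=
  (1 + Real.log (s m) / s m) * (1 - d m / s m)⁻¹ * B m

end ExpMeasure

end

/-! This is Hermite's method with explicit constants. For a parameter n and each node k ≤ m, let f_k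
be ∏ (X - i)^n over 0 ≤ i ≤ m with one factor X - k removed, and let A_{k,j} be the sum of all
derivatives of f_k at j, an integer. Integration by parts gives e^j A_{k,0} - A_{k,j} = ∫_0^j
e^(j-x) f_k(x) dx, so the A_{k,j} approximate the powers of e simultaneously. With Λ = Σ λ_j e^j
this reads Σ λ_j A_{k,j} = A_{k,0} Λ - Σ_{j≥1} λ_j (e^j A_{k,0} - A_{k,j}).

The m + 1 systems are linearly independent (`eq_zero_of_hermite_relations`), so for nonzero λ the
left side is nonzero for some k. Every A_{k,j} is divisible by `commonDivisor m n`, which is (n-1)!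
times powers of small primes (`commonDivisor_dvd`). The quotient is a nonzero integer of an
imaginary quadratic field, hence at least 1 in absolute value. This yields 1 ≤ Q_n |Λ| + H R_n
(`one_le_hermite_bound`), where Q_n bounds the divided |A_{k,0}| and R_n the divided, summed
integrals.

If R_n ≤ exp(-(n log n - c n)), taking n just beyond the solution x of x (log x - c) = log 2H forces
H R_n ≤ 1/2. So |Λ| ≥ 1/(2 Q_n), and rewriting the bound on Q_n in terms of H gives the shape of the
theorem (`lower_bound_of_estimates`).

What remains is numerical. Stirling's formula and Legendre's digit-sum formula bound the divisor
from below, and the maximum of ∏ |x - i| on [0, m] bounds the integrals. The degrees 2, 3 and 4 are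
treated separately, with a finer integral estimate near the peaks for 3 and 4; a uniform estimate
covers m ≥ 5. -/

noncomputable section

namespace ExpMeasure

open Polynomial

/-! ### Linear independence of the Hermite systems -/

/-- The polynomial `∏ i ≤ m, (X - i) ^ n` with the exponent at the node `k` lowered by one. -/
def hermitePoly (m n k : ℕ) : ℤ[X] :=
  ∏ i ∈ Finset.range (m + 1), (X - C (i : ℤ)) ^ (if i = k then n - 1 else n)

/-- The monic complex polynomial with roots `0, …, m`. -/
def nodes (m : ℕ) : ℂ[X] := Lagrange.nodal (Finset.range (m + 1)) (fun i : ℕ => (i : ℂ))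

/-- The monic complex polynomial with roots `0, …, m` except `k`. -/
def nodesErase (m k : ℕ) : ℂ[X] :=
  Lagrange.nodal ((Finset.range (m + 1)).erase k) (fun i : ℕ => (i : ℂ))

theorem nodes_eq_mul_nodesErase {m k : ℕ} (hk : k ≤ m) :
    nodes m = (X - C (k : ℂ)) * nodesErase m k :=
  Lagrange.nodal_eq_mul_nodal_erase (v := fun i : ℕ => (i : ℂ))
    (Finset.mem_range.2 (Nat.lt_succ_of_le hk))

theorem map_hermitePoly {m n k : ℕ} (hk : k ≤ m) :
    (hermitePoly m (n + 1) k).map (Int.castRingHom ℂ) = nodes m ^ n * nodesErase m k := by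
  have hk' : k ∈ Finset.range (m + 1) := Finset.mem_range.2 (Nat.lt_succ_of_le hk)
  rw [nodes_eq_mul_nodesErase hk, hermitePoly, Polynomial.map_prod,
    ← Finset.mul_prod_erase _ _ hk']
  have : ∀ i ∈ (Finset.range (m + 1)).erase k,
      ((X - C (i : ℤ)) ^ (if i = k then n + 1 - 1 else n + 1)).map (Int.castRingHom ℂ) =
        (X - C (i : ℂ)) ^ (n + 1) := by
    intro i hi
    simp [Finset.ne_of_mem_erase hi]
  rw [Finset.prod_congr rfl this, Finset.prod_pow, ← Lagrange.nodal_eq, ← nodesErase]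
  simp [mul_pow]
  ring

theorem natDegree_nodesErase {m k : ℕ} (hk : k ≤ m) : (nodesErase m k).natDegree = m := by
  rw [nodesErase, Lagrange.natDegree_nodal,
    Finset.card_erase_of_mem (Finset.mem_range.2 (Nat.lt_succ_of_le hk)), Finset.card_range]
  rfl

theorem eval_nodesErase_self_ne_zero (m k : ℕ) : (nodesErase m k).eval (k : ℂ) ≠ 0 := by
  refine Lagrange.eval_nodal_not_at_node fun i hi => ?_
  exact_mod_cast (Finset.ne_of_mem_erase hi).symm

theorem eval_nodes {m j : ℕ} (hj : j ≤ m) : (nodes m).eval (j : ℂ) = 0 :=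
  Lagrange.eval_nodal_at_node (v := fun i : ℕ => (i : ℂ))
    (Finset.mem_range.2 (Nat.lt_succ_of_le hj))

theorem eval_derivative_nodes {m k : ℕ} (hk : k ≤ m) :
    (derivative (nodes m)).eval (k : ℂ) = (nodesErase m k).eval (k : ℂ) :=
  Lagrange.eval_nodal_derivative_eval_node_eq (v := fun i : ℕ => (i : ℂ))
    (Finset.mem_range.2 (Nat.lt_succ_of_le hk))

theorem natDegree_nodes (m : ℕ) : (nodes m).natDegree = m + 1 := by
  rw [nodes, Lagrange.natDegree_nodal, Finset.card_range]

/-- Every polynomial of degree at most `m` is a linear combination of the `nodesErase m k`. -/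
theorem eq_sum_nodesErase {m : ℕ} (h : ℂ[X]) (hh : h.natDegree ≤ m) :
    ∃ c : ℕ → ℂ, h = ∑ k ∈ Finset.range (m + 1), c k • nodesErase m k := by
  have hinj : Set.InjOn (fun i : ℕ => (i : ℂ)) (Finset.range (m + 1) : Finset ℕ) :=
    fun a _ b _ hab => Nat.cast_injective hab
  have hdeg : h.degree < (Finset.range (m + 1)).card := by
    rw [Finset.card_range]
    exact lt_of_le_of_lt degree_le_natDegree (by exact_mod_cast Nat.lt_succ_of_le hh)
  have h1 := Lagrange.eq_interpolate hinj hdeg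
  have h2 : ∀ k ∈ Finset.range (m + 1), ∃ c : ℂ,
      C (h.eval (k : ℂ)) * Lagrange.basis (Finset.range (m + 1)) (fun i : ℕ => (i : ℂ)) k =
        c • nodesErase m k := by
    intro k hk
    refine ⟨h.eval (k : ℂ) * ∏ j ∈ (Finset.range (m + 1)).erase k, ((k : ℂ) - j)⁻¹, ?_⟩
    simp only [Lagrange.basis, Lagrange.basisDivisor, Finset.prod_mul_distrib, nodesErase,
      Lagrange.nodal, smul_eq_C_mul, C_mul, map_prod]
    ring
  choose! c hc using h2
  refine ⟨c, ?_⟩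
  rw [Lagrange.interpolate_apply] at h1
  conv_lhs => rw [h1]
  exact Finset.sum_congr rfl hc

section Functional

variable (m : ℕ) (lam : ℕ → ℂ)

/-- The linear functional `g ↦ ∑ j ≤ m, lam j * (∑ i, g⁽ⁱ⁾(j))`. -/
def nodeFunctional : ℂ[X] →ₗ[ℂ] ℂ :=
  ∑ j ∈ Finset.range (m + 1), lam j • ((leval (j : ℂ)).comp sumIDeriv)

theorem nodeFunctional_apply (g : ℂ[X]) :
    nodeFunctional m lam g =
      ∑ j ∈ Finset.range (m + 1), lam j * (sumIDeriv g).eval (j : ℂ) := by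
  simp [nodeFunctional, leval_apply]

/-- The sum of all derivatives telescopes on g - g', leaving g itself, so here the functional is a
plain combination of point evaluations at the nodes. -/
theorem nodeFunctional_sub_derivative (g : ℂ[X]) :
    nodeFunctional m lam (g - derivative g) =
      ∑ j ∈ Finset.range (m + 1), lam j * g.eval (j : ℂ) := by
  rw [nodeFunctional_apply]
  refine Finset.sum_congr rfl fun j _ => ?_
  have h := congrArg (eval (j : ℂ)) (sumIDeriv_eq_self_add g)
  rw [eval_add] at h
  rw [map_sub, sumIDeriv_derivative, eval_sub, h]
  ring

variable {m lam}

/-- Let u be the nodal polynomial and v = u/(X - k). All node values of u^(N+1) v are 0, so the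
functional kills u^(N+1) v minus its derivative. The hypothesis disposes of the multiples of
u^(N+1), leaving u^N u' v. Since u' and v agree at k, u' v is congruent to v(k) v modulo u, with
v(k) ≠ 0; hence u^N v is killed, and the v for varying k span the polynomials of degree at most m.
-/
theorem nodeFunctional_descend {N : ℕ}
    (h : ∀ g : ℂ[X], g.natDegree ≤ m → nodeFunctional m lam (nodes m ^ (N + 1) * g) = 0)
    (g : ℂ[X]) (hg : g.natDegree ≤ m) : nodeFunctional m lam (nodes m ^ N * g) = 0 := by
  have key : ∀ k ∈ Finset.range (m + 1),
      nodeFunctional m lam (nodes m ^ N * nodesErase m k) = 0 := by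
    intro k hk
    have hk : k ≤ m := Nat.lt_succ_iff.1 (Finset.mem_range.1 hk)
    set u := nodes m with hu
    set v := nodesErase m k with hv
    set a : ℂ := v.eval (k : ℂ) with ha
    have ha0 : a ≠ 0 := eval_nodesErase_self_ne_zero m k
    have hroot : (C a - derivative u).IsRoot (k : ℂ) := by
      simp [IsRoot, hu, eval_derivative_nodes hk, ha, hv]
    obtain ⟨e, he⟩ := dvd_iff_isRoot.2 hroot
    have hdeg : e.natDegree ≤ m := by
      by_cases he0 : e = 0
      · simp [he0]
      have h1 : (C a - derivative u).natDegree = 1 + e.natDegree := by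
        rw [he, natDegree_mul (X_sub_C_ne_zero _) he0, natDegree_X_sub_C]
      have h2 : (C a - derivative u).natDegree ≤ m := by
        refine (natDegree_sub_le _ _).trans ?_
        simp only [natDegree_C, zero_le, sup_of_le_right]
        exact (natDegree_derivative_le u).trans (by rw [hu, natDegree_nodes]; rfl)
      omega
    have e1 : a • (u ^ N * v) = u ^ N * (derivative u * v) + u ^ (N + 1) * e := by
      have : C a = derivative u + (X - C (k : ℂ)) * e := by rw [← he]; ring
      rw [smul_eq_C_mul, this, pow_succ]
      have hu' : u = (X - C (k : ℂ)) * v := nodes_eq_mul_nodesErase hk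
      calc _ = u ^ N * (derivative u * v) + u ^ N * (((X - C (k : ℂ)) * v) * e) := by ring
        _ = _ := by rw [← hu']; ring
    have e2 : u ^ (N + 1) * v - derivative (u ^ (N + 1) * v) =
        u ^ (N + 1) * (v - derivative v) - ((N : ℂ) + 1) • (u ^ N * (derivative u * v)) := by
      rw [derivative_mul, derivative_pow_succ, smul_eq_C_mul]
      simp only [map_add, map_natCast, map_one]
      ring
    have e3 := nodeFunctional_sub_derivative m lam (u ^ (N + 1) * v)
    have e4 : ∑ j ∈ Finset.range (m + 1), lam j * (u ^ (N + 1) * v).eval (j : ℂ) = 0 := by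
      refine Finset.sum_eq_zero fun j hj => ?_
      have hj : j ≤ m := Nat.lt_succ_iff.1 (Finset.mem_range.1 hj)
      simp [hu, eval_nodes hj]
    have hv' : v.natDegree = m := natDegree_nodesErase hk
    have e5 : (v - derivative v).natDegree ≤ m :=
      (natDegree_sub_le _ _).trans
        (max_le hv'.le ((natDegree_derivative_le v).trans (by omega)))
    rw [e4, e2, map_sub, h _ e5, map_smul, zero_sub, neg_eq_zero, smul_eq_zero] at e3
    have hN : ((N : ℂ) + 1) ≠ 0 := by exact_mod_cast N.succ_ne_zero
    have e6 := e3.resolve_left hN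
    have e7 := congrArg (nodeFunctional m lam) e1
    rw [map_smul, map_add, e6, h _ hdeg, add_zero, smul_eq_zero] at e7
    exact e7.resolve_left ha0
  obtain ⟨c, hc⟩ := eq_sum_nodesErase g hg
  rw [hc, Finset.mul_sum, map_sum]
  refine Finset.sum_eq_zero fun k hk => ?_
  rw [mul_smul_comm, map_smul, key k hk, smul_zero]

/-- The Hermite systems with one lowered exponent are linearly independent. -/
theorem eq_zero_of_hermite_relations {n : ℕ}
    (h : ∀ k ≤ m, ∑ j ∈ Finset.range (m + 1),
      lam j * (((sumIDeriv (hermitePoly m (n + 1) k)).eval (j : ℤ) : ℤ) : ℂ) = 0) :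
    ∀ j ≤ m, lam j = 0 := by
  -- The assumed relations say exactly that the functional kills u^n v_k for every k, with u the
  -- nodal polynomial and v_k = u/(X - k).
  have base : ∀ g : ℂ[X], g.natDegree ≤ m → nodeFunctional m lam (nodes m ^ n * g) = 0 := by
    intro g hg
    obtain ⟨c, hc⟩ := eq_sum_nodesErase g hg
    rw [hc, Finset.mul_sum, map_sum]
    refine Finset.sum_eq_zero fun k hk => ?_
    have hk : k ≤ m := Nat.lt_succ_iff.1 (Finset.mem_range.1 hk)
    rw [mul_smul_comm, map_smul, nodeFunctional_apply, ← map_hermitePoly hk, smul_eq_zero]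
    right
    rw [← h k hk]
    refine Finset.sum_congr rfl fun j _ => ?_
    rw [sumIDeriv_map]
    congr 1
    simp
  have all : ∀ N, N ≤ n → ∀ g : ℂ[X], g.natDegree ≤ m →
      nodeFunctional m lam (nodes m ^ (n - N) * g) = 0 := by
    intro N
    induction N with
    | zero => intro _; simpa using base
    | succ N ih =>
      intro hN
      refine nodeFunctional_descend ?_
      have : n - (N + 1) + 1 = n - N := by omega
      rw [this]
      exact ih (by omega)
  intro j hj
  -- With the power of the nodal polynomial brought down to 0, testing on v_j - v_j' isolates lam j
  -- times v_j(j) ≠ 0.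
  have h0 := all n le_rfl (nodesErase m j - derivative (nodesErase m j))
    ((natDegree_sub_le _ _).trans (max_le (natDegree_nodesErase hj).le
      ((natDegree_derivative_le _).trans (by rw [natDegree_nodesErase hj]; omega))))
  rw [Nat.sub_self, pow_zero, one_mul, nodeFunctional_sub_derivative,
    Finset.sum_eq_single_of_mem j (Finset.mem_range.2 (Nat.lt_succ_of_le hj))] at h0
  · exact (mul_eq_zero.1 h0).resolve_right (eval_nodesErase_self_ne_zero m j)
  · intro i hi hij
    have : (nodesErase m j).eval (i : ℂ) = 0 :=
      Lagrange.eval_nodal_at_node (v := fun i : ℕ => (i : ℂ)) (Finset.mem_erase.2 ⟨hij, hi⟩)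
    rw [this, mul_zero]

end Functional

end ExpMeasure

end

/-! ### A large common divisor of the Hermite numbers -/

noncomputable section

namespace ExpMeasure

open Polynomial

theorem eval_sumIDeriv_eq_sum_taylor (f : ℤ[X]) (r : ℤ) :
    (sumIDeriv f).eval r =
      ∑ b ∈ Finset.range (f.natDegree + 1), (taylor r f).coeff b * (b.factorial : ℤ) := by
  rw [sumIDeriv_apply, eval_finsetSum]
  refine Finset.sum_congr rfl fun b _ => ?_
  rw [taylor_coeff, ← factorial_smul_hasseDeriv]
  simp [mul_comm]

/-- `p ^ e` divides `b! * h_b` for every coefficient `h_b` of `h`. -/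
def FactorialDvd (p e : ℕ) (h : ℤ[X]) : Prop :=
  ∀ b : ℕ, ((p : ℤ) ^ e) ∣ h.coeff b * (b.factorial : ℤ)

theorem FactorialDvd.zero (p : ℕ) (h : ℤ[X]) : FactorialDvd p 0 h := fun b => by simp

/-- Under h_b ↦ b! h_b, multiplication becomes a binomial convolution with integer coefficients, so
the divisibilities multiply. -/
theorem FactorialDvd.mul {p e e' : ℕ} {h h' : ℤ[X]} (hh : FactorialDvd p e h)
    (hh' : FactorialDvd p e' h') : FactorialDvd p (e + e') (h * h') := by
  intro c
  rw [coeff_mul, Finset.sum_mul]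
  refine Finset.dvd_sum fun x hx => ?_
  have hx : x.1 + x.2 = c := Finset.HasAntidiagonal.mem_antidiagonal.1 hx
  have hc : (c.factorial : ℤ) = (c.choose x.1 : ℤ) * (x.1.factorial : ℤ) * (x.2.factorial : ℤ) := by
    have := Nat.choose_mul_factorial_mul_factorial (show x.1 ≤ c by omega)
    rw [show c - x.1 = x.2 by omega] at this
    exact_mod_cast this.symm
  rw [hc, pow_add]
  have := mul_dvd_mul (hh x.1) (hh' x.2)
  calc _ ∣ _ := this
    _ ∣ _ := ⟨c.choose x.1, by ring⟩

theorem FactorialDvd.prod {p : ℕ} {ι : Type*} (s : Finset ι) (e : ι → ℕ) (h : ι → ℤ[X])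
    (hh : ∀ i ∈ s, FactorialDvd p (e i) (h i)) :
    FactorialDvd p (∑ i ∈ s, e i) (∏ i ∈ s, h i) := by
  classical
  induction s using Finset.induction_on with
  | empty => simpa using FactorialDvd.zero p 1
  | insert a s ha ih =>
    rw [Finset.sum_insert ha, Finset.prod_insert ha]
    exact (hh a (Finset.mem_insert_self a s)).mul
      (ih fun i hi => hh i (Finset.mem_insert_of_mem hi))

theorem padicValNat_factorial_le (p n : ℕ) [hp : Fact p.Prime] :
    padicValNat p n.factorial ≤ n := by
  have h := sub_one_mul_padicValNat_factorial (p := p) n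
  have h1 : 1 ≤ p - 1 := by have := hp.out.two_le; omega
  calc _ = 1 * padicValNat p n.factorial := (one_mul _).symm
    _ ≤ (p - 1) * padicValNat p n.factorial := Nat.mul_le_mul_right _ h1
    _ ≤ n := by omega

/-- Here b! · C(l, b) = l!/(l - b)!. The p-part lost to (l - b)! is at most p^(l-b), which the
factor a^(l-b) restores. -/
theorem FactorialDvd.X_add_C_pow (p l : ℕ) [hp : Fact p.Prime] {a : ℤ} (ha : (p : ℤ) ∣ a) :
    FactorialDvd p (padicValNat p l.factorial) ((X + C a) ^ l) := by
  intro b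
  rw [coeff_X_add_C_pow]
  rcases lt_or_ge l b with hb | hb
  · simp [Nat.choose_eq_zero_of_lt hb]
  have h1 : p ^ padicValNat p l.factorial ∣ p ^ (l - b) * (l.choose b * b.factorial) := by
    have hne : l.choose b * b.factorial ≠ 0 :=
      mul_ne_zero (Nat.choose_pos hb).ne' b.factorial_ne_zero
    have hpne : p ^ (l - b) ≠ 0 := pow_ne_zero _ hp.out.ne_zero
    rw [padicValNat_dvd_iff_le (mul_ne_zero hpne hne), padicValNat.mul hpne hne,
      padicValNat.prime_pow]
    have h2 := Nat.choose_mul_factorial_mul_factorial hb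
    rw [← h2, padicValNat.mul hne (Nat.factorial_ne_zero _)]
    have := padicValNat_factorial_le p (l - b)
    omega
  have h2 : (p : ℤ) ^ (l - b) ∣ a ^ (l - b) := pow_dvd_pow_of_dvd ha _
  have h3 : ((p : ℤ) ^ padicValNat p l.factorial) ∣
      (p : ℤ) ^ (l - b) * ((l.choose b : ℤ) * (b.factorial : ℤ)) := by exact_mod_cast h1
  calc _ ∣ _ := h3
    _ ∣ a ^ (l - b) * ((l.choose b : ℤ) * (b.factorial : ℤ)) := mul_dvd_mul_right h2 _
    _ = _ := by ring

theorem FactorialDvd.dvd_eval {p e : ℕ} {f : ℤ[X]} {r : ℤ} (h : FactorialDvd p e (taylor r f)) :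
    ((p : ℤ) ^ e) ∣ (sumIDeriv f).eval r := by
  rw [eval_sumIDeriv_eq_sum_taylor]
  exact Finset.dvd_sum fun b _ => h b

theorem taylor_hermitePoly (m n k : ℕ) (j : ℤ) :
    taylor j (hermitePoly m n k) =
      ∏ i ∈ Finset.range (m + 1), (X + C (j - (i : ℤ))) ^ (if i = k then n - 1 else n) := by
  rw [taylor_apply, hermitePoly, Polynomial.prod_comp]
  refine Finset.prod_congr rfl fun i _ => ?_
  rw [pow_comp, sub_comp, X_comp, C_comp, C_sub]
  ring

theorem minFloor_le {m j : ℕ} (p : ℕ) (hj : j ≤ m) : minFloor m p ≤ j / p + (m - j) / p :=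
  Finset.inf'_le _ (Finset.mem_range.2 (Nat.lt_succ_of_le hj))

/-- There are ⌊j/p⌋ nodes below j and ⌊(m - j)/p⌋ above it in the residue class of j mod p; the
extra 1 is j itself. -/
theorem card_modEq_ge {m j p : ℕ} (hp : 0 < p) (hj : j ≤ m) :
    minFloor m p + 1 ≤
      ((Finset.range (m + 1)).filter (fun i : ℕ => (p : ℤ) ∣ (j : ℤ) - i)).card := by
  refine (Nat.succ_le_succ (minFloor_le p hj)).trans ?_
  rw [← Finset.card_range (Nat.succ (j / p + (m - j) / p))]
  refine Finset.card_le_card_of_injOn (fun t => j % p + p * t) ?_ ?_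
  · intro t ht
    have ht : t ≤ j / p + (m - j) / p := Nat.lt_succ_iff.1 (Finset.mem_range.1 ht)
    have h1 := Nat.mod_add_div j p
    have h2 := Nat.mul_div_le (m - j) p
    have h3 : p * t ≤ p * (j / p) + p * ((m - j) / p) := by
      rw [← mul_add]; exact Nat.mul_le_mul_left p ht
    simp only [Finset.coe_filter, Finset.mem_range, Set.mem_ofPred_eq]
    refine ⟨by omega, ?_⟩
    refine ⟨(j / p : ℕ) - (t : ℤ), ?_⟩
    have h4 : ((j % p : ℕ) : ℤ) + (p : ℤ) * ((j / p : ℕ) : ℤ) = j := by exact_mod_cast h1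
    rw [Nat.cast_add, Nat.cast_mul]
    linear_combination -h4
  · intro a _ b _ hab
    have : p * a = p * b := by simpa using hab
    exact Nat.eq_of_mul_eq_mul_left hp this

/-- After recentring at j, each factor whose node is congruent to j mod p contributes the p-part of
the factorial of its exponent. At most one of these exponents is the lowered n - 1, which accounts
for the single (n - 1)!. -/
theorem pow_dvd_hermite {m n k j p : ℕ} [hp : Fact p.Prime] (hj : j ≤ m) :
    ((p : ℤ) ^ (padicValNat p (n - 1).factorial + minFloor m p * padicValNat p n.factorial)) ∣
      (sumIDeriv (hermitePoly m n k)).eval (j : ℤ) := by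
  classical
  set l : ℕ → ℕ := fun i => if i = k then n - 1 else n with hl
  set T := (Finset.range (m + 1)).filter (fun i : ℕ => (p : ℤ) ∣ (j : ℤ) - i) with hT
  have h1 : FactorialDvd p (∑ i ∈ Finset.range (m + 1),
      if (p : ℤ) ∣ (j : ℤ) - i then padicValNat p (l i).factorial else 0)
      (taylor (j : ℤ) (hermitePoly m n k)) := by
    rw [taylor_hermitePoly]
    refine FactorialDvd.prod _ _ _ fun i _ => ?_
    by_cases h : (p : ℤ) ∣ (j : ℤ) - i
    · rw [if_pos h]
      exact FactorialDvd.X_add_C_pow p (l i) h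
    · rw [if_neg h]
      exact FactorialDvd.zero _ _
  refine dvd_trans (pow_dvd_pow _ ?_) h1.dvd_eval
  rw [← Finset.sum_filter, ← hT]
  have hcard : minFloor m p + 1 ≤ T.card := card_modEq_ge hp.out.pos hj
  by_cases hk : k ∈ T
  · rw [← Finset.add_sum_erase _ _ hk]
    have h2 : ∑ i ∈ T.erase k, padicValNat p (l i).factorial =
        (T.card - 1) * padicValNat p n.factorial := by
      rw [← Finset.card_erase_of_mem hk, ← smul_eq_mul, ← Finset.sum_const]
      refine Finset.sum_congr rfl fun i hi => ?_
      simp [hl, Finset.ne_of_mem_erase hi]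
    rw [h2]
    have h3 : l k = n - 1 := by simp [hl]
    rw [h3]
    gcongr
    omega
  · have h2 : ∑ i ∈ T, padicValNat p (l i).factorial =
        T.card * padicValNat p n.factorial := by
      rw [← smul_eq_mul, ← Finset.sum_const]
      refine Finset.sum_congr rfl fun i hi => ?_
      have : i ≠ k := fun h => hk (h ▸ hi)
      simp [hl, this]
    rw [h2]
    have h3 : padicValNat p (n - 1).factorial ≤ padicValNat p n.factorial :=
      (padicValNat_dvd_iff_le n.factorial_ne_zero).1
        (pow_padicValNat_dvd.trans (Nat.factorial_dvd_factorial (Nat.sub_le n 1)))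
    calc _ ≤ padicValNat p n.factorial + minFloor m p * padicValNat p n.factorial := by gcongr
      _ = (minFloor m p + 1) * padicValNat p n.factorial := by ring
      _ ≤ _ := Nat.mul_le_mul_right _ hcard

/-- The primes over which the sum defining `kappa m` runs. -/
def smallPrimes (m : ℕ) : Finset ℕ :=
  (Finset.range (m + 1)).filter (fun p => p.Prime ∧ 2 * p ≤ m + 1)

theorem prime_of_mem_smallPrimes {m p : ℕ} (hp : p ∈ smallPrimes m) : p.Prime :=
  (Finset.mem_filter.1 hp).2.1

/-- A common divisor of all the numbers of the Hermite systems. -/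
def commonDivisor (m n : ℕ) : ℕ :=
  (n - 1).factorial * ∏ p ∈ smallPrimes m, p ^ (minFloor m p * padicValNat p n.factorial)

theorem commonDivisor_pos (m n : ℕ) : 0 < commonDivisor m n :=
  Nat.mul_pos (Nat.factorial_pos _)
    (Finset.prod_pos fun _ hp => pow_pos (prime_of_mem_smallPrimes hp).pos _)

theorem commonDivisor_dvd {m n k j : ℕ} (hj : j ≤ m) :
    (commonDivisor m n : ℤ) ∣ (sumIDeriv (hermitePoly m n k)).eval (j : ℤ) := by
  rw [Int.natCast_dvd]
  refine (Nat.dvd_iff_prime_pow_dvd_dvd _ _).2 fun q a hq hqa => ?_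
  have : Fact q.Prime := ⟨hq⟩
  have h1 : a ≤ padicValNat q (commonDivisor m n) :=
    (padicValNat_dvd_iff_le (commonDivisor_pos m n).ne').1 hqa
  have hne : ∏ p ∈ smallPrimes m, p ^ (minFloor m p * padicValNat p n.factorial) ≠ 0 :=
    Finset.prod_ne_zero_iff.2 fun p hp => pow_ne_zero _ (prime_of_mem_smallPrimes hp).ne_zero
  -- A prime q outside `smallPrimes m` contributes nothing here, so only an inequality is claimed;
  -- it is all that is needed.
  have h2 : padicValNat q (∏ p ∈ smallPrimes m, p ^ (minFloor m p * padicValNat p n.factorial)) ≤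
      minFloor m q * padicValNat q n.factorial := by
    rw [← Nat.factorization_def _ hq, Nat.factorization_prod fun p hp =>
      pow_ne_zero _ (prime_of_mem_smallPrimes hp).ne_zero, Finsupp.finsetSum_apply]
    have h3 : ∀ p ∈ smallPrimes m,
        (p ^ (minFloor m p * padicValNat p n.factorial)).factorization q =
          if p = q then minFloor m q * padicValNat q n.factorial else 0 := by
      intro p hp
      rw [(prime_of_mem_smallPrimes hp).factorization_pow, Finsupp.single_apply]
      split_ifs with h
      · rw [h]
      · rfl
    rw [Finset.sum_congr rfl h3, Finset.sum_ite_eq']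
    split_ifs <;> simp
  rw [commonDivisor, padicValNat.mul (Nat.factorial_ne_zero _) hne] at h1
  have h4 := pow_dvd_hermite (m := m) (n := n) (k := k) (p := q) hj
  have h5 : q ^ (padicValNat q (n - 1).factorial + minFloor m q * padicValNat q n.factorial) ∣
      ((sumIDeriv (hermitePoly m n k)).eval (j : ℤ)).natAbs :=
    Int.natCast_dvd.1 (by exact_mod_cast h4)
  exact (pow_dvd_pow q (by omega)).trans h5

end ExpMeasure

end

/-! ### Size of the common divisor through digit sums -/

noncomputable section

namespace ExpMeasure

/-- Bernoulli's inequality with exponent b/(p-1) ≤ 1, that is p^(b/(p-1)) ≤ 1 + b. -/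
theorem digit_mul_log_le {p b : ℕ} (hp : 2 ≤ p) (hb : b < p) :
    (b : ℝ) * (Real.log p / ((p : ℝ) - 1)) ≤ Real.log (b + 1) := by
  have hp' : (2 : ℝ) ≤ p := by exact_mod_cast hp
  have hp1 : (0 : ℝ) < (p : ℝ) - 1 := by linarith
  have hb' : (b : ℝ) ≤ (p : ℝ) - 1 := by
    have : (b : ℝ) + 1 ≤ p := by exact_mod_cast hb
    linarith
  have h := rpow_one_add_le_one_add_mul_self (s := (p : ℝ) - 1)
    (p := (b : ℝ) / ((p : ℝ) - 1)) (by linarith) (by positivity) ((div_le_one hp1).2 hb')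
  rw [div_mul_cancel₀ _ hp1.ne', add_sub_cancel] at h
  have h2 := Real.log_le_log (Real.rpow_pos_of_pos (by linarith) _) h
  rw [Real.log_rpow (by linarith), add_comm (1 : ℝ)] at h2
  calc _ = (b : ℝ) / ((p : ℝ) - 1) * Real.log p := by ring
    _ ≤ _ := h2

/-- Adding the bounds for single digits, this rests on ∏ (digit + 1) ≤ n + 1, obtained by splitting
off the lowest digit. -/
theorem digits_sum_mul_log_le {p : ℕ} (hp : 2 ≤ p) (n : ℕ) :
    ((p.digits n).sum : ℝ) * (Real.log p / ((p : ℝ) - 1)) ≤ Real.log (n + 1) := by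
  induction n using Nat.strong_induction_on with
  | _ n ih =>
    rcases Nat.eq_zero_or_pos n with rfl | hn
    · simp
    rw [Nat.digits_def' hp hn, List.sum_cons]
    have h1 := ih (n / p) (Nat.div_lt_self hn hp)
    have h2 := digit_mul_log_le hp (Nat.mod_lt n (by omega : 0 < p))
    have h3 : (n % p + 1) * (n / p + 1) ≤ n + 1 := by
      have h4 := Nat.mod_add_div n p
      have h5 := Nat.mod_lt n (by omega : 0 < p)
      have h6 : (n % p + 1) * (n / p) ≤ p * (n / p) := Nat.mul_le_mul_right _ h5
      calc _ = (n % p + 1) * (n / p) + (n % p + 1) := by ring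
        _ ≤ _ := by omega
    have h4 : Real.log (((n % p : ℕ) : ℝ) + 1) + Real.log (((n / p : ℕ) : ℝ) + 1) ≤
        Real.log (n + 1) := by
      rw [← Real.log_mul (by positivity) (by positivity)]
      exact Real.log_le_log (by positivity) (by exact_mod_cast h3)
    push_cast at *
    rw [add_mul]
    linarith

/-- Legendre: (p - 1) v_p(n!) equals n minus the base-p digit sum, so the loss against the main term
is only logarithmic. -/
theorem padicValNat_factorial_mul_log_ge {p : ℕ} (hp : p.Prime) (n : ℕ) :
    (n : ℝ) * (Real.log p / ((p : ℝ) - 1)) - Real.log (n + 1) ≤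
      (padicValNat p n.factorial : ℝ) * Real.log p := by
  have : Fact p.Prime := ⟨hp⟩
  have hp2 : (2 : ℝ) ≤ p := by exact_mod_cast hp.two_le
  have hp1 : (0 : ℝ) < (p : ℝ) - 1 := by linarith
  have h := sub_one_mul_padicValNat_factorial (p := p) n
  have h1 : ((p : ℝ) - 1) * (padicValNat p n.factorial : ℝ) =
      (n : ℝ) - ((p.digits n).sum : ℝ) := by
    rw [← Nat.cast_sub (Nat.digit_sum_le p n), ← h, Nat.cast_mul, Nat.cast_sub hp.one_le,
      Nat.cast_one]
  have h2 := digits_sum_mul_log_le hp.two_le n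
  have h3 : (padicValNat p n.factorial : ℝ) * Real.log p =
      (((p : ℝ) - 1) * (padicValNat p n.factorial : ℝ)) * (Real.log p / ((p : ℝ) - 1)) := by
    field_simp
  rw [h3, h1, sub_mul]
  linarith

/-- The limit of `m * kappa m` when the weights `w p` are replaced by `1`. -/
def primeWeight (m : ℕ) : ℝ :=
  ∑ p ∈ smallPrimes m, (minFloor m p : ℝ) * (Real.log p / ((p : ℝ) - 1))

/-- The sum of the multiplicities `minFloor m p` over the small primes. -/
def primeCount (m : ℕ) : ℝ := ∑ p ∈ smallPrimes m, (minFloor m p : ℝ)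

theorem log_commonDivisor_ge (m n : ℕ) :
    Real.log (n - 1).factorial + (n : ℝ) * primeWeight m - primeCount m * Real.log (n + 1) ≤
      Real.log (commonDivisor m n) := by
  have h0 : ∀ p ∈ smallPrimes m,
      ((p : ℝ) ^ (minFloor m p * padicValNat p n.factorial)) ≠ 0 := fun p hp =>
    pow_ne_zero _ (Nat.cast_ne_zero.2 (prime_of_mem_smallPrimes hp).ne_zero)
  rw [commonDivisor]
  push_cast
  rw [Real.log_mul (by positivity) (Finset.prod_ne_zero_iff.2 h0), Real.log_prod h0, add_sub_assoc]
  refine add_le_add le_rfl ?_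
  rw [primeWeight, primeCount, Finset.mul_sum, Finset.sum_mul, ← Finset.sum_sub_distrib]
  refine Finset.sum_le_sum fun p hp => ?_
  have h := padicValNat_factorial_mul_log_ge (prime_of_mem_smallPrimes hp) n
  rw [Real.log_pow]
  push_cast
  calc _ = (minFloor m p : ℝ) *
        ((n : ℝ) * (Real.log p / ((p : ℝ) - 1)) - Real.log (n + 1)) := by ring
    _ ≤ (minFloor m p : ℝ) * ((padicValNat p n.factorial : ℝ) * Real.log p) := by gcongr
    _ = _ := by ring

end ExpMeasure

end

/-! ### Hermite's integral identity and the basic inequality for the linear form -/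

noncomputable section

namespace ExpMeasure

open Polynomial MeasureTheory

/-- The value of `hermitePoly m n k` at a real point. -/
def hermiteEval (m n k : ℕ) (x : ℝ) : ℝ :=
  ∏ i ∈ Finset.range (m + 1), (x - i) ^ (if i = k then n - 1 else n)

theorem continuous_hermiteEval (m n k : ℕ) : Continuous (hermiteEval m n k) := by
  unfold hermiteEval; fun_prop

theorem eval_map_hermitePoly (m n k : ℕ) (x : ℝ) :
    ((hermitePoly m n k).map (Int.castRingHom ℝ)).eval x = hermiteEval m n k x := by
  rw [hermitePoly, Polynomial.map_prod, eval_prod, hermiteEval]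
  refine Finset.prod_congr rfl fun i _ => ?_
  rw [Polynomial.map_pow, eval_pow]
  simp

/-- With G the sum of all derivatives of g, G - G' = g makes -e^(t-x) G(x) an antiderivative of the
integrand. -/
theorem exp_mul_eval_sumIDeriv_sub (g : ℝ[X]) (t : ℝ) :
    Real.exp t * (sumIDeriv g).eval 0 - (sumIDeriv g).eval t =
      ∫ x in (0 : ℝ)..t, Real.exp (t - x) * g.eval x := by
  have h : ∀ x ∈ Set.uIcc 0 t,
      HasDerivAt (fun x => -(Real.exp (t - x) * (sumIDeriv g).eval x))
        (Real.exp (t - x) * g.eval x) x := by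
    intro x _
    have h1 : HasDerivAt (fun x : ℝ => Real.exp (t - x)) (Real.exp (t - x) * (-1)) x :=
      ((hasDerivAt_id x).const_sub t).exp
    have h2 := (h1.mul ((sumIDeriv g).hasDerivAt x)).neg
    refine h2.congr_deriv ?_
    have h3 := congrArg (eval x) (sumIDeriv_eq_self_add g)
    rw [eval_add] at h3
    linear_combination Real.exp (t - x) * h3
  rw [intervalIntegral.integral_eq_sub_of_hasDerivAt h
    (Continuous.intervalIntegrable (by fun_prop) _ _)]
  simp
  ring

theorem exp_mul_hermite_sub (m n k j : ℕ) :
    Real.exp j * ((sumIDeriv (hermitePoly m n k)).eval 0 : ℤ) -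
        ((sumIDeriv (hermitePoly m n k)).eval (j : ℤ) : ℤ) =
      ∫ x in (0 : ℝ)..j, Real.exp (j - x) * hermiteEval m n k x := by
  have h := exp_mul_eval_sumIDeriv_sub ((hermitePoly m n k).map (Int.castRingHom ℝ)) j
  simp only [eval_map_hermitePoly] at h
  rw [← h, sumIDeriv_map]
  have h1 := eval_intCast_map (Int.castRingHom ℝ) (sumIDeriv (hermitePoly m n k)) (j : ℤ)
  have h0 := eval_intCast_map (Int.castRingHom ℝ) (sumIDeriv (hermitePoly m n k)) 0
  simp only [Int.cast_natCast, Int.cast_zero, eq_intCast] at h1 h0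
  rw [h1, h0]

theorem abs_exp_mul_hermite_sub_le {m n k j : ℕ} (hj : j ≤ m) {J : ℝ}
    (hJ : ∫ x in (0 : ℝ)..m, Real.exp (-x) * |hermiteEval m n k x| ≤ J) :
    |Real.exp j * ((sumIDeriv (hermitePoly m n k)).eval 0 : ℤ) -
        ((sumIDeriv (hermitePoly m n k)).eval (j : ℤ) : ℤ)| ≤ Real.exp j * J := by
  rw [exp_mul_hermite_sub]
  have hcont := continuous_hermiteEval m n k
  have hc : Continuous fun x : ℝ => Real.exp (-x) * |hermiteEval m n k x| := by fun_prop
  calc |∫ x in (0 : ℝ)..j, Real.exp (j - x) * hermiteEval m n k x|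
      ≤ ∫ x in (0 : ℝ)..j, |Real.exp (j - x) * hermiteEval m n k x| :=
        intervalIntegral.abs_integral_le_integral_abs (Nat.cast_nonneg j)
    _ = Real.exp j * ∫ x in (0 : ℝ)..j, Real.exp (-x) * |hermiteEval m n k x| := by
        rw [← intervalIntegral.integral_const_mul]
        refine intervalIntegral.integral_congr fun x _ => ?_
        rw [abs_mul, abs_of_pos (Real.exp_pos _), sub_eq_add_neg, Real.exp_add, mul_assoc]
    _ ≤ Real.exp j * J := by
        refine mul_le_mul_of_nonneg_left (le_trans ?_ hJ) (Real.exp_pos _).le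
        refine intervalIntegral.integral_mono_interval le_rfl (Nat.cast_nonneg j)
          (by exact_mod_cast hj) ?_ (hc.intervalIntegrable _ _)
        exact Filter.Eventually.of_forall fun x => by positivity

theorem integrableOn_exp_neg_mul_pow (b : ℕ) :
    IntegrableOn (fun x : ℝ => Real.exp (-x) * x ^ b) (Set.Ioi 0) := by
  have h := Real.GammaIntegral_convergent (s := (b : ℝ) + 1) (by positivity)
  simpa using h

theorem integral_exp_neg_mul_pow (b : ℕ) :
    ∫ x in Set.Ioi (0 : ℝ), Real.exp (-x) * x ^ b = b.factorial := by
  rw [← Real.Gamma_nat_eq_factorial, Real.Gamma_eq_integral (by positivity)]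
  simp

/-- Termwise this is ∫ e^(-x) x^b dx = b!. -/
theorem eval_zero_eq_integral (f : ℤ[X]) :
    (((sumIDeriv f).eval 0 : ℤ) : ℝ) =
      ∫ x in Set.Ioi (0 : ℝ), Real.exp (-x) * (f.map (Int.castRingHom ℝ)).eval x := by
  rw [eval_sumIDeriv_eq_sum_taylor, taylor_zero]
  have h : ∀ x : ℝ, Real.exp (-x) * (f.map (Int.castRingHom ℝ)).eval x =
      ∑ b ∈ Finset.range (f.natDegree + 1), (f.coeff b : ℝ) * (Real.exp (-x) * x ^ b) := by
    intro x
    rw [eval_map, eval₂_eq_sum_range, Finset.mul_sum]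
    refine Finset.sum_congr rfl fun b _ => ?_
    simp only [eq_intCast]
    ring
  simp only [h]
  rw [integral_finsetSum _ fun b _ => (integrableOn_exp_neg_mul_pow b).const_mul _]
  push_cast
  refine Finset.sum_congr rfl fun b _ => ?_
  rw [integral_const_mul, integral_exp_neg_mul_pow]

theorem sum_exponents {m k n : ℕ} (hk : k ≤ m) (hn : 1 ≤ n) :
    ∑ i ∈ Finset.range (m + 1), (if i = k then n - 1 else n) = (m + 1) * n - 1 := by
  have hk' : k ∈ Finset.range (m + 1) := Finset.mem_range.2 (Nat.lt_succ_of_le hk)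
  rw [← Finset.add_sum_erase _ _ hk', if_pos rfl,
    Finset.sum_congr rfl fun i hi => if_neg (Finset.ne_of_mem_erase hi), Finset.sum_const,
    Finset.card_erase_of_mem hk', Finset.card_range, smul_eq_mul, Nat.add_sub_cancel,
    Nat.add_mul, Nat.one_mul]
  omega

theorem abs_hermiteEval_le_pow {m k n : ℕ} (hk : k ≤ m) (hn : 1 ≤ n) {x c : ℝ}
    (h : ∀ i ≤ m, |x - i| ≤ c) : |hermiteEval m n k x| ≤ c ^ ((m + 1) * n - 1) := by
  rw [hermiteEval, Finset.abs_prod, ← sum_exponents hk hn, ← Finset.prod_pow_eq_pow_sum]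
  refine Finset.prod_le_prod (fun _ _ => abs_nonneg _) fun i hi => ?_
  rw [abs_pow]
  exact pow_le_pow_left₀ (abs_nonneg _) (h i (Nat.lt_succ_iff.1 (Finset.mem_range.1 hi))) _

theorem abs_hermiteEval_le_add {m k n : ℕ} (hk : k ≤ m) (hn : 1 ≤ n) {x : ℝ} (hx : 0 ≤ x) :
    |hermiteEval m n k x| ≤ x ^ ((m + 1) * n - 1) + (m : ℝ) ^ ((m + 1) * n - 1) := by
  rcases le_total x m with hxm | hxm
  · refine (abs_hermiteEval_le_pow hk hn (c := m) fun i hi => ?_).trans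
      (le_add_of_nonneg_left (by positivity))
    have : (i : ℝ) ≤ m := by exact_mod_cast hi
    have : (0 : ℝ) ≤ i := Nat.cast_nonneg i
    rw [abs_le]; constructor <;> linarith
  · refine (abs_hermiteEval_le_pow hk hn (c := x) fun i hi => ?_).trans
      (le_add_of_nonneg_right (by positivity))
    have : (i : ℝ) ≤ m := by exact_mod_cast hi
    have : (0 : ℝ) ≤ i := Nat.cast_nonneg i
    rw [abs_le]; constructor <;> linarith

/-- From L^L/L! ≤ e^L ≤ 3^L and 3m ≤ L. -/
theorem pow_le_factorial {m L : ℕ} (h : 3 * m ≤ L) : (m : ℝ) ^ L ≤ L.factorial := by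
  have h1 := Real.pow_div_factorial_le_exp (L : ℝ) (Nat.cast_nonneg L) L
  rw [div_le_iff₀ (by positivity)] at h1
  have h2 : Real.exp L ≤ 3 ^ L := by
    rw [← Real.exp_one_pow]
    exact pow_le_pow_left₀ (Real.exp_pos 1).le Real.exp_one_lt_three.le L
  have h3 : (3 : ℝ) ^ L * (m : ℝ) ^ L ≤ 3 ^ L * L.factorial := by
    calc _ = ((3 * m : ℕ) : ℝ) ^ L := by push_cast; rw [mul_pow]
      _ ≤ (L : ℝ) ^ L := by gcongr
      _ ≤ Real.exp L * L.factorial := h1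
      _ ≤ _ := by gcongr
  exact le_of_mul_le_mul_left h3 (by positivity)

theorem abs_hermite_zero_le {m k n : ℕ} (hk : k ≤ m) (hn : 4 ≤ n) :
    |(((sumIDeriv (hermitePoly m n k)).eval 0 : ℤ) : ℝ)| ≤
      2 * (((m + 1) * n - 1).factorial : ℝ) := by
  set L := (m + 1) * n - 1 with hL
  have hn1 : 1 ≤ n := by omega
  rw [eval_zero_eq_integral]
  simp only [eval_map_hermitePoly]
  have hint : IntegrableOn (fun x : ℝ => Real.exp (-x) * x ^ L +
      (m : ℝ) ^ L * (Real.exp (-x) * x ^ 0)) (Set.Ioi 0) :=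
    (integrableOn_exp_neg_mul_pow L).add ((integrableOn_exp_neg_mul_pow 0).const_mul _)
  have h1 : |∫ x in Set.Ioi (0 : ℝ), Real.exp (-x) * hermiteEval m n k x| ≤
      ∫ x in Set.Ioi (0 : ℝ), (Real.exp (-x) * x ^ L +
        (m : ℝ) ^ L * (Real.exp (-x) * x ^ 0)) := by
    rw [← Real.norm_eq_abs]
    refine norm_integral_le_of_norm_le hint ?_
    filter_upwards [ae_restrict_mem measurableSet_Ioi] with x hx
    rw [Real.norm_eq_abs, abs_mul, abs_of_pos (Real.exp_pos _)]
    calc _ ≤ Real.exp (-x) * (x ^ L + (m : ℝ) ^ L) :=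
          mul_le_mul_of_nonneg_left (abs_hermiteEval_le_add hk hn1 (le_of_lt hx))
            (Real.exp_pos _).le
      _ = _ := by ring
  refine h1.trans ?_
  rw [integral_add (integrableOn_exp_neg_mul_pow L)
    ((integrableOn_exp_neg_mul_pow 0).const_mul _), integral_const_mul,
    integral_exp_neg_mul_pow, integral_exp_neg_mul_pow]
  -- This is where n ≥ 4 enters; it lets the part of the integral over [0, m] be absorbed in the
  -- second copy of L!.
  have h2 : 3 * m ≤ L := by
    have : (m + 1) * 4 ≤ (m + 1) * n := Nat.mul_le_mul_left _ hn
    omega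
  have := pow_le_factorial h2
  simp
  linarith

/-- A nonzero integer of an imaginary quadratic field has absolute value at least one. -/
theorem one_le_norm_embedding (K : Type*) [Field K] [NumberField K]
    [Algebra.IsQuadraticExtension ℚ K] [NumberField.IsTotallyComplex K] (σ : K →+* ℂ)
    (a : NumberField.RingOfIntegers K) (ha : a ≠ 0) : 1 ≤ ‖σ (a : K)‖ := by
  classical
  -- A single complex place remains, so the product formula reads |σ a|² = |Norm a|, a positive
  -- integer.
  have hcard : Fintype.card (NumberField.InfinitePlace K) = 1 := by
    have h1 := NumberField.IsTotallyComplex.finrank (K := K)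
    have h2 := Algebra.IsQuadraticExtension.finrank_eq_two ℚ K
    have h3 := NumberField.InfinitePlace.card_eq_nrRealPlaces_add_nrComplexPlaces K
    have h4 := NumberField.IsTotallyComplex.nrRealPlaces_eq_zero (K := K)
    omega
  have hprod := NumberField.InfinitePlace.prod_eq_abs_norm (a : K)
  obtain ⟨w0, hw0⟩ := Fintype.card_eq_one_iff.1 hcard
  rw [Fintype.prod_eq_single (NumberField.InfinitePlace.mk σ) fun w hw =>
      absurd ((hw0 w).trans (hw0 _).symm) hw, NumberField.IsTotallyComplex.mult_eq,
    NumberField.InfinitePlace.apply] at hprod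
  have hnorm : Algebra.norm ℤ a ≠ 0 := Algebra.norm_ne_zero_iff.2 ha
  have h1 : (1 : ℝ) ≤ ‖σ (a : K)‖ ^ 2 := by
    rw [hprod, ← Algebra.coe_norm_int]
    have : (1 : ℤ) ≤ |Algebra.norm ℤ a| := Int.one_le_abs hnorm
    exact_mod_cast this
  by_contra! h
  have := pow_lt_one₀ (norm_nonneg (σ (a : K))) h two_ne_zero
  linarith

/-- After division by the common divisor, the combination Σ λ_j A_j is a nonzero algebraic integer
for a suitable k. The linear form enters with the coefficient A_0, and the remainders e^j A_0 - A_j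
carry the factor H. -/
theorem one_le_hermite_bound (K : Type*) [Field K] [NumberField K]
    [Algebra.IsQuadraticExtension ℚ K] [NumberField.IsTotallyComplex K] (σ : K →+* ℂ)
    {m : ℕ} {H : ℝ} (hH : 0 < H) (lam : Fin (m + 1) → NumberField.RingOfIntegers K)
    (hlam : lam ≠ 0) (hbound : ∀ j : Fin (m + 1), 1 ≤ (j : ℕ) → ‖σ (lam j : K)‖ ≤ H)
    {n : ℕ} (hn : 4 ≤ n) {J : ℝ}
    (hJ : ∀ k ≤ m, ∫ x in (0 : ℝ)..m, Real.exp (-x) * |hermiteEval m n k x| ≤ J) :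
    1 ≤ 2 * (((m + 1) * n - 1).factorial : ℝ) / commonDivisor m n *
          ‖∑ j : Fin (m + 1), σ (lam j : K) * Complex.exp 1 ^ (j : ℕ)‖ +
        H * ((∑ j ∈ Finset.range m, Real.exp (j + 1)) * J / commonDivisor m n) := by
  classical
  set Λ := ∑ j : Fin (m + 1), σ (lam j : K) * Complex.exp 1 ^ (j : ℕ) with hΛ
  have hD : (0 : ℝ) < commonDivisor m n := by exact_mod_cast commonDivisor_pos m n
  -- If the combination vanished for every k, linear independence of the Hermite systems would force
  -- all coefficients to be 0.
  obtain ⟨k, hk, hne⟩ : ∃ k ≤ m, ∑ j : Fin (m + 1), σ (lam j : K) *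
      (((sumIDeriv (hermitePoly m n k)).eval ((j : ℕ) : ℤ) : ℤ) : ℂ) ≠ 0 := by
    by_contra! h
    apply hlam
    obtain ⟨n', rfl⟩ : ∃ n', n = n' + 1 := ⟨n - 1, by omega⟩
    have := eq_zero_of_hermite_relations (m := m) (n := n')
      (lam := fun j => if hj : j < m + 1 then σ (lam ⟨j, hj⟩ : K) else 0) (fun k hk => by
        rw [← h k hk, Finset.sum_range]
        refine Finset.sum_congr rfl fun j _ => ?_
        rw [dif_pos j.2])
    funext j
    have h1 := this j (Nat.lt_succ_iff.1 j.2)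
    rw [dif_pos j.2] at h1
    simpa using h1
  have hdvd : ∀ j : Fin (m + 1), ∃ b : ℤ,
      (sumIDeriv (hermitePoly m n k)).eval ((j : ℕ) : ℤ) = (commonDivisor m n : ℤ) * b :=
    fun j => commonDivisor_dvd (Nat.lt_succ_iff.1 j.2)
  choose b hb using hdvd
  set A : Fin (m + 1) → ℝ := fun j =>
    (((sumIDeriv (hermitePoly m n k)).eval ((j : ℕ) : ℤ) : ℤ) : ℝ) with hA
  set W : NumberField.RingOfIntegers K := ∑ j, lam j * (b j : NumberField.RingOfIntegers K) with hW
  have hσW : ∑ j : Fin (m + 1), σ (lam j : K) * ((A j : ℝ) : ℂ) =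
      (commonDivisor m n : ℂ) * σ (W : K) := by
    rw [hW]
    push_cast
    rw [map_sum, Finset.mul_sum]
    refine Finset.sum_congr rfl fun j _ => ?_
    simp only [hA, hb j, map_mul]
    push_cast
    simp
    ring
  have hW0 : W ≠ 0 := by
    intro h
    apply hne
    rw [h] at hσW
    simpa [hA] using hσW
  have hW1 := one_le_norm_embedding K σ W hW0
  have hnorm : (commonDivisor m n : ℝ) ≤ ‖∑ j : Fin (m + 1), σ (lam j : K) * ((A j : ℝ) : ℂ)‖ := by
    rw [hσW, norm_mul, Complex.norm_natCast]
    exact le_mul_of_one_le_right hD.le hW1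
  have hA0 : |A 0| ≤ 2 * (((m + 1) * n - 1).factorial : ℝ) := by
    simpa [hA] using abs_hermite_zero_le hk hn
  have hsplit : ∑ j : Fin (m + 1), σ (lam j : K) * ((A j : ℝ) : ℂ) =
      ((A 0 : ℝ) : ℂ) * Λ - ∑ j : Fin (m + 1), σ (lam j : K) *
        ((Real.exp ((j : ℕ) : ℝ) * A 0 - A j : ℝ) : ℂ) := by
    rw [hΛ, Finset.mul_sum, ← Finset.sum_sub_distrib]
    refine Finset.sum_congr rfl fun j _ => ?_
    push_cast
    rw [← Complex.exp_nat_mul, mul_one]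
    ring
  have hrem : ‖∑ j : Fin (m + 1), σ (lam j : K) *
      ((Real.exp ((j : ℕ) : ℝ) * A 0 - A j : ℝ) : ℂ)‖ ≤
      H * ((∑ j ∈ Finset.range m, Real.exp (j + 1)) * J) := by
    rw [Fin.sum_univ_succ]
    -- The remainder at j = 0 is identically 0, which is why no bound on `lam 0` is required.
    have h0 : (Real.exp (((0 : Fin (m + 1)) : ℕ) : ℝ) * A 0 - A 0 : ℝ) = 0 := by simp
    rw [h0, Complex.ofReal_zero, mul_zero, zero_add, Finset.sum_range, Finset.sum_mul,
      Finset.mul_sum]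
    refine norm_sum_le_of_le _ fun j _ => ?_
    rw [norm_mul, Complex.norm_real, Real.norm_eq_abs]
    refine mul_le_mul (hbound j.succ (by simp)) ?_ (abs_nonneg _) hH.le
    have := abs_exp_mul_hermite_sub_le (m := m) (n := n) (k := k) (j := (j.succ : ℕ))
      (Nat.lt_succ_iff.1 j.succ.2) (hJ k hk)
    simpa [hA] using this
  have h1 : (commonDivisor m n : ℝ) ≤ 2 * (((m + 1) * n - 1).factorial : ℝ) * ‖Λ‖ +
      H * ((∑ j ∈ Finset.range m, Real.exp (j + 1)) * J) := by
    refine hnorm.trans ?_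
    rw [hsplit]
    refine (norm_sub_le _ _).trans (add_le_add ?_ hrem)
    rw [norm_mul, Complex.norm_real, Real.norm_eq_abs]
    exact mul_le_mul_of_nonneg_right hA0 (norm_nonneg _)
  calc (1 : ℝ) = commonDivisor m n / commonDivisor m n := (div_self hD.ne').symm
    _ ≤ (2 * (((m + 1) * n - 1).factorial : ℝ) * ‖Λ‖ +
      H * ((∑ j ∈ Finset.range m, Real.exp (j + 1)) * J)) / commonDivisor m n := by gcongr
    _ = _ := by ring

end ExpMeasure

end

/-! ### Choice of the parameter n in terms of H -/

noncomputable section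

namespace ExpMeasure

theorem exists_mul_log_sub_eq {x₀ c Y : ℝ} (hx₀ : 0 < x₀) (hY : x₀ * (Real.log x₀ - c) ≤ Y) :
    ∃ x, x₀ ≤ x ∧ x * (Real.log x - c) = Y := by
  set b := max x₀ (max Y (Real.exp (c + 1))) with hb
  have hx₀b : x₀ ≤ b := le_max_left _ _
  have hYb : Y ≤ b := (le_max_left _ _).trans (le_max_right _ _)
  have hcb : Real.exp (c + 1) ≤ b := (le_max_right _ _).trans (le_max_right _ _)
  have hb0 : 0 < b := hx₀.trans_le hx₀b
  have hlog : c + 1 ≤ Real.log b := (Real.le_log_iff_exp_le hb0).2 hcb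
  have hcont : ContinuousOn (fun x : ℝ => x * (Real.log x - c)) (Set.Icc x₀ b) := by
    refine continuousOn_id.mul (ContinuousOn.sub (Real.continuousOn_log.mono ?_)
      continuousOn_const)
    intro x hx
    exact (hx₀.trans_le hx.1).ne'
  obtain ⟨x, hx, hxY⟩ := intermediate_value_Icc hx₀b hcont
    (show Y ∈ Set.Icc (x₀ * (Real.log x₀ - c)) (b * (Real.log b - c)) from
      ⟨hY, by nlinarith⟩)
  exact ⟨x, hx.1, hxY⟩

/-- With t = log x one has x = Y/(t - c) and log Y ≤ t + log t. The ratio (t + log t)/(t - c) for t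
≥ s is at most (s + log s)/(s - d), since both log t / t and c/t are largest at t = s and c ≤ d. -/
theorem le_mul_div_log {s d c x Y : ℝ} (hs : Real.exp 1 ≤ s) (hc : 0 ≤ c) (hcd : c ≤ d)
    (hds : d + 1 ≤ s) (hx : Real.exp s ≤ x) (hY : x * (Real.log x - c) = Y) :
    1 < Y ∧ x ≤ (s + Real.log s) / (s - d) * (Y / Real.log Y) := by
  have hs0 : 0 < s := (Real.exp_pos 1).trans_le hs
  have hx0 : 0 < x := (Real.exp_pos s).trans_le hx
  set t := Real.log x with ht
  have hts : s ≤ t := (Real.le_log_iff_exp_le hx0).2 hx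
  have ht0 : 0 < t := hs0.trans_le hts
  have hx1 : 1 < x := (Real.one_lt_exp_iff.2 hs0).trans_le hx
  have htc : 1 ≤ t - c := by linarith
  have hY1 : 1 < Y := by rw [← hY]; nlinarith
  refine ⟨hY1, ?_⟩
  have hlogY0 : 0 < Real.log Y := Real.log_pos hY1
  have hlogY : Real.log Y ≤ t + Real.log t := by
    rw [← hY, Real.log_mul hx0.ne' (by linarith)]
    have := Real.log_le_log (show 0 < t - c by linarith) (show t - c ≤ t by linarith)
    linarith
  -- The function log t / t decreases only from e onwards; this is the role of s ≥ e.
  have hanti : Real.log t / t ≤ Real.log s / s :=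
    Real.log_div_self_antitoneOn hs (hs.trans hts) hts
  have h1 : s * Real.log Y ≤ t * (s + Real.log s) := by
    rw [div_le_div_iff₀ ht0 hs0] at hanti
    nlinarith
  have hlogs : 0 ≤ Real.log s := Real.log_nonneg (by have := Real.add_one_le_exp 1; linarith)
  have h2 : t * (s - d) ≤ s * (t - c) := by nlinarith
  rw [div_mul_div_comm, le_div_iff₀ (mul_pos (by linarith) hlogY0)]
  have h3 : s * ((s - d) * Real.log Y) ≤ s * ((s + Real.log s) * (t - c)) := by
    calc s * ((s - d) * Real.log Y) = (s - d) * (s * Real.log Y) := by ring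
      _ ≤ (s - d) * (t * (s + Real.log s)) := by gcongr; linarith
      _ = (s + Real.log s) * (t * (s - d)) := by ring
      _ ≤ (s + Real.log s) * (s * (t - c)) := by gcongr
      _ = _ := by ring
  have h4 := le_of_mul_le_mul_left h3 hs0
  calc _ ≤ x * ((s + Real.log s) * (t - c)) := mul_le_mul_of_nonneg_left h4 hx0.le
    _ = (s + Real.log s) * (x * (t - c)) := by ring
    _ = _ := by rw [hY]

theorem add_one_mul_log_le {x : ℝ} (hx : 0 < x) :
    (x + 1) * Real.log (x + 1) ≤ x * Real.log x + Real.log x + 1 + 1 / x := by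
  have h : Real.log (x + 1) ≤ Real.log x + 1 / x := by
    have h1 := Real.log_le_sub_one_of_pos (show 0 < (x + 1) / x by positivity)
    rw [Real.log_div (by positivity) hx.ne'] at h1
    have h2 : (x + 1) / x - 1 = 1 / x := by field_simp; ring
    linarith
  calc _ ≤ (x + 1) * (Real.log x + 1 / x) := by gcongr
    _ = _ := by field_simp; ring

/-- From approximation estimates for all large `n` to a lower bound for the linear form. -/
theorem lower_bound_of_estimates {m : ℕ} {s d c B D β γ x₀ H Λ : ℝ} {Q R : ℕ → ℝ}
    (hH : 0 < H) (hΛ : 0 ≤ Λ) (hs : Real.exp 1 ≤ s) (hc : 0 ≤ c) (hcd : c ≤ d)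
    (hds : d + 1 ≤ s) (hB : 0 ≤ B) (hβ : 0 ≤ β) (hβB : β = B - m * c)
    (hD : β - γ + m + m / x₀ ≤ D) (hx₀ : Real.exp s ≤ x₀)
    (hY : x₀ * (Real.log x₀ - c) ≤ Real.log (2 * H))
    (hmain : ∀ n : ℕ, x₀ < n → 1 ≤ Q n * Λ + H * R n)
    (hR : ∀ n : ℕ, x₀ < n → R n ≤ Real.exp (-(n * Real.log n - c * n)))
    (hQ : ∀ n : ℕ, x₀ < n → Q n ≤ Real.exp (m * (n * Real.log n) + β * n - γ)) :
    1 / (2 * Real.exp D) * ((s - d) / (s + Real.log s) *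
        (Real.log (Real.log (2 * H)) / Real.log (2 * H))) ^ m *
        (2 * H) ^ (-(m : ℝ) - (1 + Real.log s / s) * (1 - d / s)⁻¹ * B /
          Real.log (Real.log (2 * H))) ≤ Λ := by
  have hs0 : 0 < s := (Real.exp_pos 1).trans_le hs
  have hx₀0 : 0 < x₀ := (Real.exp_pos s).trans_le hx₀
  obtain ⟨x, hx₀x, hxY⟩ := exists_mul_log_sub_eq hx₀0 hY
  have hx0 : 0 < x := hx₀0.trans_le hx₀x
  set Y := Real.log (2 * H) with hYdef
  obtain ⟨hY1, hxle⟩ := le_mul_div_log hs hc hcd hds (hx₀.trans hx₀x) hxY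
  have hlogY0 : 0 < Real.log Y := Real.log_pos hY1
  have hY0 : 0 < Y := by linarith
  have hlogs : 0 ≤ Real.log s := Real.log_nonneg (by have := Real.add_one_le_exp 1; linarith)
  have hts : s ≤ Real.log x := (Real.le_log_iff_exp_le hx0).2 (hx₀.trans hx₀x)
  -- The next integer after x: x < n makes the remainder small enough, while n ≤ x + 1 keeps the
  -- coefficient of the linear form under control.
  set n := ⌊x⌋₊ + 1 with hn
  have hxn : x < n := by rw [hn]; push_cast; exact Nat.lt_floor_add_one x
  have hnx : (n : ℝ) ≤ x + 1 := by
    rw [hn]; push_cast; linarith [Nat.floor_le hx0.le]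
  have hn0 : (0 : ℝ) < n := hx0.trans hxn
  have hxn' : x₀ < n := hx₀x.trans_lt hxn
  have hlogn : Real.log x ≤ Real.log n := Real.log_le_log hx0 hxn.le
  have hRn : H * R n ≤ 1 / 2 := by
    have h1 : Y ≤ n * Real.log n - c * n := by
      rw [← hxY]
      have : x * (Real.log x - c) ≤ n * (Real.log n - c) :=
        mul_le_mul hxn.le (by linarith) (by linarith) hn0.le
      linarith
    have h2 : R n ≤ Real.exp (-Y) := (hR n hxn').trans (Real.exp_le_exp.2 (by linarith))
    rw [hYdef, Real.exp_neg, Real.exp_log (by linarith)] at h2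
    calc H * R n ≤ H * (2 * H)⁻¹ := by gcongr
      _ = 1 / 2 := by field_simp
  have hΛ2 : 1 / 2 ≤ Real.exp (m * (n * Real.log n) + β * n - γ) * Λ := by
    have h1 := hmain n hxn'
    have h2 := mul_le_mul_of_nonneg_right (hQ n hxn') hΛ
    linarith
  have hq : m * (n * Real.log n) + β * n - γ ≤ m * Y + B * x + m * Real.log x + D := by
    have h1 : (n : ℝ) * Real.log n ≤ x * Real.log x + Real.log x + 1 + 1 / x := by
      refine le_trans ?_ (add_one_mul_log_le hx0)
      exact mul_le_mul hnx (Real.log_le_log hn0 hnx) (by linarith) (by linarith)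
    have h2 : β * n ≤ β * (x + 1) := by gcongr
    have h3 : (m : ℝ) * (n * Real.log n) ≤
        m * (x * Real.log x + Real.log x + 1 + 1 / x) := by gcongr
    have h4 : (m : ℝ) / x ≤ m / x₀ := by gcongr
    have h5 : (m : ℝ) * (x * Real.log x) = m * Y + m * c * x := by rw [← hxY]; ring
    have h6 : (m : ℝ) * (x * Real.log x + Real.log x + 1 + 1 / x) =
        m * (x * Real.log x) + m * Real.log x + m + m / x := by ring
    have h7 : β * (x + 1) = B * x - m * c * x + β := by rw [hβB]; ring
    linarith
  have hfin : 1 / 2 ≤ Real.exp (m * Y + B * x + m * Real.log x + D) * Λ :=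
    hΛ2.trans (by gcongr)
  have hinv : (s - d) / (s + Real.log s) * (Real.log Y / Y) ≤ x⁻¹ := by
    have h1 := inv_anti₀ hx0 hxle
    rwa [mul_inv, inv_div, inv_div] at h1
  -- The bound for x in terms of Y/log Y turns the factor e^(Bx) into a power of 2H; the constant
  -- produced is `Bhat`.
  have hBx : B * x ≤ Y * ((1 + Real.log s / s) * (1 - d / s)⁻¹ * B / Real.log Y) := by
    have hsd : s - d ≠ 0 := by linarith
    have : Y * ((1 + Real.log s / s) * (1 - d / s)⁻¹ * B / Real.log Y) =
        B * ((s + Real.log s) / (s - d) * (Y / Real.log Y)) := by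
      have h1 : (1 - d / s) = (s - d) / s := by field_simp
      rw [h1, inv_div]
      field_simp
    rw [this]
    gcongr
  have hpow : ((s - d) / (s + Real.log s) * (Real.log Y / Y)) ^ m ≤
      Real.exp (-(m * Real.log x)) := by
    refine (pow_le_pow_left₀ (mul_nonneg (div_nonneg (by linarith) (by linarith))
      (div_nonneg hlogY0.le hY0.le)) hinv m).trans (le_of_eq ?_)
    rw [Real.exp_neg, Real.exp_nat_mul, Real.exp_log hx0, inv_pow]
  have hrpow : (2 * H) ^ (-(m : ℝ) - (1 + Real.log s / s) * (1 - d / s)⁻¹ * B / Real.log Y) ≤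
      Real.exp (-(m * Y) - B * x) := by
    rw [Real.rpow_def_of_pos (by linarith), ← hYdef]
    refine Real.exp_le_exp.2 ?_
    rw [mul_sub]
    linarith
  calc _ ≤ 1 / (2 * Real.exp D) * Real.exp (-(m * Real.log x)) *
        Real.exp (-(m * Y) - B * x) := by gcongr
    _ = 1 / 2 * Real.exp (-(m * Y + B * x + m * Real.log x + D)) := by
        rw [show -(m * Y + B * x + m * Real.log x + D) =
          -D + (-(m * Real.log x)) + (-(m * Y) - B * x) by ring, Real.exp_add, Real.exp_add,
          Real.exp_neg D]
        field_simp
    _ ≤ (Real.exp (m * Y + B * x + m * Real.log x + D) * Λ) *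
        Real.exp (-(m * Y + B * x + m * Real.log x + D)) := by gcongr
    _ = Λ := by rw [Real.exp_neg]; field_simp

end ExpMeasure

end

/-! ### Stirling estimates for the coefficient and the remainder -/

noncomputable section

namespace ExpMeasure

/-- The comparison number 6.25 = 5²/2² reduces the estimate to log 2 and log 5. -/
theorem half_log_two_pi_ge : 0.918 ≤ Real.log (2 * Real.pi) / 2 := by
  have h1 : (6.28 : ℝ) ≤ 2 * Real.pi := by linarith [Real.pi_gt_d2]
  have h2 : Real.log (6.25 : ℝ) = 2 * Real.log 5 - 2 * Real.log 2 := by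
    rw [show (6.25 : ℝ) = 5 ^ 2 / 2 ^ 2 by norm_num, Real.log_div (by norm_num) (by norm_num),
      Real.log_pow, Real.log_pow]
    norm_num
  have h3 := Real.log_le_log (by norm_num) h1
  have h4 := Real.one_sub_inv_le_log_of_pos (show (0 : ℝ) < 6.28 / 6.25 by norm_num)
  rw [Real.log_div (by norm_num) (by norm_num), h2] at h4
  have h5 := Real.log_two_lt_d9
  have h6 := Real.log_five_gt_d9
  norm_num at h4 h5 h6 h3 ⊢
  linarith

theorem log_factorial_pred_ge {n : ℕ} (hn : 1 ≤ n) :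
    n * Real.log n - n - Real.log n / 2 + 0.918 ≤ Real.log (n - 1).factorial := by
  have h1 := Stirling.le_log_factorial_stirling (n := n) (by omega)
  have hn0 : (0 : ℝ) < n := by exact_mod_cast hn
  rw [← Nat.mul_factorial_pred (by omega : n ≠ 0), Nat.cast_mul,
    Real.log_mul hn0.ne' (by positivity)] at h1
  linarith [half_log_two_pi_ge]

theorem log_factorial_le_of_le {a n : ℕ} (ha : 1 ≤ a) (han : a ≤ n) :
    Real.log n.factorial ≤ n * Real.log n - n + Real.log n / 2 +
      (Real.log a.factorial - (a * Real.log a - a + Real.log a / 2)) := by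
  have h := Stirling.log_stirlingSeq'_antitone (show a - 1 ≤ n - 1 by omega)
  simp only [Function.comp, Nat.succ_eq_add_one, Nat.sub_add_cancel ha,
    Nat.sub_add_cancel (ha.trans han), Stirling.log_stirlingSeq_formula] at h
  have ha0 : (a : ℝ) ≠ 0 := by positivity
  have hn0 : (n : ℝ) ≠ 0 := by have := ha.trans han; positivity
  rw [Real.log_mul two_ne_zero ha0, Real.log_mul two_ne_zero hn0,
    Real.log_div ha0 (Real.exp_ne_zero 1), Real.log_div hn0 (Real.exp_ne_zero 1),
    Real.log_exp] at h
  linarith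

/-- Comparison with a = 1, where the excess over the Stirling main term is exactly 1. -/
theorem log_factorial_pred_le {N : ℕ} (hN : 1 ≤ N) :
    Real.log (N - 1).factorial ≤ N * Real.log N - N + 1 - Real.log N / 2 := by
  have h1 := log_factorial_le_of_le le_rfl hN
  have hN0 : (0 : ℝ) < N := by exact_mod_cast hN
  rw [← Nat.mul_factorial_pred (by omega : N ≠ 0), Nat.cast_mul,
    Real.log_mul hN0.ne' (by positivity)] at h1
  simp at h1
  linarith

/-- The half-logarithms of n in numerator and denominator cancel, and log 2 + 1 - 0.918 is rounded
up to 1. -/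
theorem log_hermite_quotient_le {m n : ℕ} (hn : 1 ≤ n) :
    2 * (((m + 1) * n - 1).factorial : ℝ) / commonDivisor m n ≤
      Real.exp (m * (n * Real.log n) +
        (((m : ℝ) + 1) * Real.log (m + 1) - m - primeWeight m) * n + 1 +
          primeCount m * Real.log (n + 1)) := by
  have hD : (0 : ℝ) < commonDivisor m n := by exact_mod_cast commonDivisor_pos m n
  have hn0 : (0 : ℝ) < n := by exact_mod_cast hn
  have hm0 : (0 : ℝ) < (m : ℝ) + 1 := by positivity
  rw [← Real.log_le_iff_le_exp (by positivity), Real.log_div (by positivity) hD.ne',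
    Real.log_mul two_ne_zero (by positivity)]
  have h1 := log_commonDivisor_ge m n
  have h2 := log_factorial_pred_ge hn
  have h3 := log_factorial_pred_le (N := (m + 1) * n) (by
    exact Nat.mul_pos m.succ_pos hn)
  have h4 : Real.log (((m + 1) * n : ℕ) : ℝ) = Real.log ((m : ℝ) + 1) + Real.log n := by
    push_cast
    exact Real.log_mul hm0.ne' hn0.ne'
  rw [h4] at h3
  push_cast at h3
  have h5 : 0 ≤ Real.log ((m : ℝ) + 1) := Real.log_nonneg (by linarith [Nat.cast_nonneg (α := ℝ) m])
  have h6 := Real.log_two_lt_d9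
  have h7 : ((m : ℝ) + 1) * n * (Real.log ((m : ℝ) + 1) + Real.log n) =
      m * (n * Real.log n) + n * Real.log n + ((m : ℝ) + 1) * Real.log (m + 1) * n := by ring
  rw [h7] at h3
  have h8 : (((m : ℝ) + 1) * Real.log (m + 1) - m - primeWeight m) * n =
      ((m : ℝ) + 1) * Real.log (m + 1) * n - m * n - n * primeWeight m := by ring
  rw [h8]
  linarith

theorem log_hermite_remainder_le {m n : ℕ} (hn : 1 ≤ n) {S τ : ℝ} (hS : S ≤ Real.exp τ) :
    S / commonDivisor m n ≤ Real.exp (τ - (n * Real.log n - n - Real.log n / 2 + 0.918 +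
      n * primeWeight m - primeCount m * Real.log (n + 1))) := by
  have hD : (0 : ℝ) < commonDivisor m n := by exact_mod_cast commonDivisor_pos m n
  have h1 := log_commonDivisor_ge m n
  have h2 := log_factorial_pred_ge hn
  have h3 : Real.exp (n * Real.log n - n - Real.log n / 2 + 0.918 +
      n * primeWeight m - primeCount m * Real.log (n + 1)) ≤ commonDivisor m n :=
    (Real.le_log_iff_exp_le hD).1 (by linarith)
  rw [Real.exp_sub]
  exact div_le_div₀ (Real.exp_pos _).le hS (Real.exp_pos _) h3

/-- The numerical interface used for every m. The constant c ≤ d governs the remainder; lowering it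
below d gives the bound on Q extra linear room in n, and γ compensates for the increase of B - m c
in the condition on D. The threshold x₀ may exceed e^s as far as log 2H permits, since larger n
makes the logarithmic errors relatively smaller. -/
theorem linear_form_lower_bound (K : Type*) [Field K] [NumberField K]
    [Algebra.IsQuadraticExtension ℚ K] [NumberField.IsTotallyComplex K] (σ : K →+* ℂ)
    {m : ℕ} {H : ℝ} (hH : 0 < H) (lam : Fin (m + 1) → NumberField.RingOfIntegers K)
    (hlam : lam ≠ 0) (hbound : ∀ j : Fin (m + 1), 1 ≤ (j : ℕ) → ‖σ (lam j : K)‖ ≤ H)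
    {s d c B D γ x₀ : ℝ} {J τ : ℕ → ℝ} (hs : Real.exp 1 ≤ s) (hc : 0 ≤ c) (hcd : c ≤ d)
    (hds : d + 1 ≤ s) (hB : 0 ≤ B) (hβ : 0 ≤ B - m * c)
    (hD : B - m * c - γ + m + m / x₀ ≤ D) (hx₀ : Real.exp s ≤ x₀)
    (hY : x₀ * (Real.log x₀ - c) ≤ Real.log (2 * H))
    (hJ : ∀ n : ℕ, x₀ < n → ∀ k ≤ m,
      ∫ x in (0 : ℝ)..m, Real.exp (-x) * |hermiteEval m n k x| ≤ J n)
    (hτ : ∀ n : ℕ, x₀ < n → (∑ j ∈ Finset.range m, Real.exp (j + 1)) * J n ≤ Real.exp (τ n))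
    (hR : ∀ n : ℕ, x₀ < n → τ n + Real.log n / 2 + primeCount m * Real.log (n + 1) ≤
      (c - 1 + primeWeight m) * n + 0.918)
    (hQ : ∀ n : ℕ, x₀ < n → (((m : ℝ) + 1) * Real.log (m + 1) - m - primeWeight m) * n + 1 +
      primeCount m * Real.log (n + 1) ≤ (B - m * c) * n - γ) :
    1 / (2 * Real.exp D) * ((s - d) / (s + Real.log s) *
        (Real.log (Real.log (2 * H)) / Real.log (2 * H))) ^ m *
        (2 * H) ^ (-(m : ℝ) - (1 + Real.log s / s) * (1 - d / s)⁻¹ * B /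
          Real.log (Real.log (2 * H))) ≤
      ‖∑ j : Fin (m + 1), σ (lam j : K) * Complex.exp 1 ^ (j : ℕ)‖ := by
  have hfour : ∀ n : ℕ, x₀ < n → 4 ≤ n := by
    intro n hn
    have h1 := Real.exp_one_gt_d9
    have h2 : (4 : ℝ) < n := by
      have h3 := Real.add_one_le_exp (s - 1)
      have h4 : Real.exp s = Real.exp (s - 1) * Real.exp 1 := by
        rw [← Real.exp_add]; congr 1; ring
      nlinarith
    exact_mod_cast h2.le
  refine lower_bound_of_estimates (Q := fun n =>
      2 * (((m + 1) * n - 1).factorial : ℝ) / commonDivisor m n)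
    (R := fun n => (∑ j ∈ Finset.range m, Real.exp (j + 1)) * J n / commonDivisor m n)
    hH (norm_nonneg _) hs hc hcd hds hB hβ rfl hD hx₀ hY ?_ ?_ ?_
  · intro n hn
    exact one_le_hermite_bound K σ hH lam hlam hbound (hfour n hn) (hJ n hn)
  · intro n hn
    refine (log_hermite_remainder_le (by have := hfour n hn; omega) (hτ n hn)).trans
      (Real.exp_le_exp.2 ?_)
    have := hR n hn
    linarith
  · intro n hn
    refine (log_hermite_quotient_le (by have := hfour n hn; omega)).trans
      (Real.exp_le_exp.2 ?_)
    have := hQ n hn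
    linarith

end ExpMeasure

end

/-! ### Integral estimates from the maximum of the distance product -/

noncomputable section

namespace ExpMeasure

open MeasureTheory

/-- The distance product `∏ i ≤ m, |x - i|`. -/
def nodeProd (m : ℕ) (x : ℝ) : ℝ := ∏ i ∈ Finset.range (m + 1), |x - i|

theorem nodeProd_nonneg (m : ℕ) (x : ℝ) : 0 ≤ nodeProd m x :=
  Finset.prod_nonneg fun _ _ => abs_nonneg _

theorem abs_hermiteEval_eq {m k n : ℕ} (hk : k ≤ m) (hn : 1 ≤ n) (x : ℝ) :
    |hermiteEval m n k x| = nodeProd m x ^ (n - 1) *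
      ∏ i ∈ (Finset.range (m + 1)).erase k, |x - i| := by
  have hk' : k ∈ Finset.range (m + 1) := Finset.mem_range.2 (Nat.lt_succ_of_le hk)
  obtain ⟨n, rfl⟩ : ∃ n', n = n' + 1 := ⟨n - 1, by omega⟩
  rw [hermiteEval, Finset.abs_prod, nodeProd, ← Finset.mul_prod_erase _ _ hk',
    ← Finset.mul_prod_erase _ (fun i : ℕ => |x - i|) hk', mul_pow, ← Finset.prod_pow, mul_assoc,
    ← Finset.prod_mul_distrib]
  congr 1
  · simp
  · refine Finset.prod_congr rfl fun i hi => ?_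
    rw [if_neg (Finset.ne_of_mem_erase hi), abs_pow, Nat.add_sub_cancel, pow_succ]

theorem abs_sub_node_le {m i : ℕ} {x : ℝ} (hx0 : 0 ≤ x) (hxm : x ≤ m) (hi : i ≤ m) :
    |x - i| ≤ m := by
  have : (i : ℝ) ≤ m := by exact_mod_cast hi
  have : (0 : ℝ) ≤ i := Nat.cast_nonneg i
  rw [abs_le]; constructor <;> linarith

theorem abs_hermiteEval_le_of_nodeProd_le {m k n : ℕ} (hk : k ≤ m) (hn : 1 ≤ n) {x M : ℝ}
    (hx0 : 0 ≤ x) (hxm : x ≤ m) (hM : nodeProd m x ≤ M) :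
    |hermiteEval m n k x| ≤ (m : ℝ) ^ m * M ^ (n - 1) := by
  have hk' : k ∈ Finset.range (m + 1) := Finset.mem_range.2 (Nat.lt_succ_of_le hk)
  rw [abs_hermiteEval_eq hk hn, mul_comm]
  refine mul_le_mul ?_ (pow_le_pow_left₀ (nodeProd_nonneg m x) hM _)
    (pow_nonneg (nodeProd_nonneg m x) _) (by positivity)
  calc _ ≤ ∏ _i ∈ (Finset.range (m + 1)).erase k, (m : ℝ) :=
        Finset.prod_le_prod (fun _ _ => abs_nonneg _) fun i hi => abs_sub_node_le hx0 hxm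
          (Nat.lt_succ_iff.1 (Finset.mem_range.1 (Finset.mem_of_mem_erase hi)))
    _ = _ := by rw [Finset.prod_const, Finset.card_erase_of_mem hk', Finset.card_range]; rfl

/-- Away from the nodes the missing factor |x - k| is restored at the price of 1/a, which avoids the
cruder m^m. -/
theorem abs_hermiteEval_le_div {m k n : ℕ} (hk : k ≤ m) (hn : 1 ≤ n) {x M a : ℝ} (ha : 0 < a)
    (hax : ∀ i : ℕ, i ≤ m → a ≤ |x - i|) (hM : nodeProd m x ≤ M) :
    |hermiteEval m n k x| ≤ M ^ n / a := by
  have hk' : k ∈ Finset.range (m + 1) := Finset.mem_range.2 (Nat.lt_succ_of_le hk)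
  rw [le_div_iff₀ ha]
  calc |hermiteEval m n k x| * a ≤ |hermiteEval m n k x| * |x - k| := by
        gcongr; exact hax k hk
    _ = nodeProd m x ^ (n - 1) * nodeProd m x := by
        rw [abs_hermiteEval_eq hk hn, mul_assoc, mul_comm (∏ i ∈ _, _) |x - k|,
          Finset.mul_prod_erase _ (fun i : ℕ => |x - i|) hk', nodeProd]
    _ = nodeProd m x ^ n := by rw [← pow_succ, Nat.sub_add_cancel hn]
    _ ≤ M ^ n := pow_le_pow_left₀ (nodeProd_nonneg m x) hM _

theorem integral_exp_neg (p q : ℝ) :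
    ∫ x in p..q, Real.exp (-x) = Real.exp (-p) - Real.exp (-q) := by
  rw [intervalIntegral.integral_comp_neg (fun x => Real.exp x), integral_exp]

theorem integral_exp_neg_mul_le {g : ℝ → ℝ} (hg : Continuous g) {p q A c : ℝ} (hpq : p ≤ q)
    (h : ∀ x ∈ Set.Icc p q, Real.exp (-x) * g x ≤ Real.exp (-x) * A + c) :
    ∫ x in p..q, Real.exp (-x) * g x ≤ A * (Real.exp (-p) - Real.exp (-q)) + (q - p) * c := by
  refine (intervalIntegral.integral_mono_on hpq
    (Continuous.intervalIntegrable (by fun_prop) _ _)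
    (Continuous.intervalIntegrable (by fun_prop) _ _) h).trans (le_of_eq ?_)
  rw [intervalIntegral.integral_add (Continuous.intervalIntegrable (by fun_prop) _ _)
    (Continuous.intervalIntegrable (by fun_prop) _ _), intervalIntegral.integral_mul_const,
    integral_exp_neg, intervalIntegral.integral_const, smul_eq_mul]
  ring

theorem integral_hermite_le {m k n : ℕ} (hk : k ≤ m) (hn : 1 ≤ n) {M : ℝ} (hM0 : 0 ≤ M)
    (hM : ∀ x : ℝ, 0 ≤ x → x ≤ m → nodeProd m x ≤ M) :
    ∫ x in (0 : ℝ)..m, Real.exp (-x) * |hermiteEval m n k x| ≤ (m : ℝ) ^ m * M ^ (n - 1) := by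
  have hcont := continuous_hermiteEval m n k
  have h := integral_exp_neg_mul_le (g := fun x => |hermiteEval m n k x|) (by fun_prop)
    (p := 0) (q := m) (A := (m : ℝ) ^ m * M ^ (n - 1)) (c := 0) (Nat.cast_nonneg m)
    (fun x hx => by
      rw [add_zero]
      exact mul_le_mul_of_nonneg_left
        (abs_hermiteEval_le_of_nodeProd_le hk hn hx.1 hx.2 (hM x hx.1 hx.2)) (Real.exp_pos _).le)
  refine h.trans ?_
  have h1 := Real.exp_pos (-(m : ℝ))
  have h2 : (0 : ℝ) ≤ (m : ℝ) ^ m * M ^ (n - 1) := by positivity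
  rw [neg_zero, Real.exp_zero]
  nlinarith

/-- The integral bound when the product of the distances to the nodes is nearly maximal only on
`[a, b]` and on its mirror image. -/
theorem integral_hermite_le_of_peaks {m k n : ℕ} (hk : k ≤ m) (hn : 1 ≤ n) {M M₁ a b : ℝ}
    (ha : 0 < a) (hab : a ≤ b) (hb : b + a ≤ 1) (hm : 2 ≤ m) (hM₁ : 0 ≤ M₁)
    (hM : ∀ x : ℝ, 0 ≤ x → x ≤ m → nodeProd m x ≤ M)
    (h0 : ∀ x : ℝ, 0 ≤ x → x ≤ a → nodeProd m x ≤ M₁)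
    (h1 : ∀ x : ℝ, b ≤ x → x ≤ m - b → nodeProd m x ≤ M₁)
    (h2 : ∀ x : ℝ, m - a ≤ x → x ≤ m → nodeProd m x ≤ M₁) :
    ∫ x in (0 : ℝ)..m, Real.exp (-x) * |hermiteEval m n k x| ≤
      (b - a) * (Real.exp (-a) + Real.exp (-(m - b))) * (M ^ n / a) +
        (m : ℝ) ^ m * M₁ ^ (n - 1) := by
  have hcont := continuous_hermiteEval m n k
  have hg : Continuous fun x => |hermiteEval m n k x| := by fun_prop
  have hm2 : (2 : ℝ) ≤ m := by exact_mod_cast hm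
  have hb2 : b ≤ m - b := by linarith
  set A := (m : ℝ) ^ m * M₁ ^ (n - 1) with hA
  have hA0 : 0 ≤ A := by positivity
  have hM0 : 0 ≤ M := (nodeProd_nonneg m 0).trans (hM 0 le_rfl (by linarith))
  have hP : 0 ≤ M ^ n / a := by positivity
  have hfar : ∀ x : ℝ, (a ≤ x ∧ x ≤ b) ∨ (m - b ≤ x ∧ x ≤ m - a) →
      ∀ i : ℕ, i ≤ m → a ≤ |x - i| := by
    intro x hx i hi
    have hi' : (i : ℝ) ≤ m := by exact_mod_cast hi
    rcases hx with ⟨h3, h4⟩ | ⟨h3, h4⟩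
    · rcases Nat.eq_zero_or_pos i with rfl | hi0
      · rw [le_abs]; left; push_cast; linarith
      · have : (1 : ℝ) ≤ i := by exact_mod_cast hi0
        rw [le_abs]; right; linarith
    · rcases Nat.lt_or_ge i m with hlt | hge
      · have : (i : ℝ) + 1 ≤ m := by exact_mod_cast hlt
        rw [le_abs]; left; linarith
      · have : (m : ℝ) ≤ i := by exact_mod_cast hge
        rw [le_abs]; right; linarith
  have outer : ∀ p q : ℝ, p ≤ q → 0 ≤ p → q ≤ m →
      (∀ x : ℝ, p ≤ x → x ≤ q → nodeProd m x ≤ M₁) →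
      ∫ x in p..q, Real.exp (-x) * |hermiteEval m n k x| ≤
        A * (Real.exp (-p) - Real.exp (-q)) := by
    intro p q hpq hp hq h
    have := integral_exp_neg_mul_le hg (A := A) (c := 0) hpq (fun x hx => by
      rw [add_zero]
      exact mul_le_mul_of_nonneg_left (abs_hermiteEval_le_of_nodeProd_le hk hn
        (hp.trans hx.1) (hx.2.trans hq) (h x hx.1 hx.2)) (Real.exp_pos _).le)
    simpa using this
  have inner : ∀ p q : ℝ, p ≤ q → 0 ≤ p → q ≤ m →
      (∀ x : ℝ, p ≤ x → x ≤ q → ∀ i : ℕ, i ≤ m → a ≤ |x - i|) →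
      ∫ x in p..q, Real.exp (-x) * |hermiteEval m n k x| ≤
        A * (Real.exp (-p) - Real.exp (-q)) + (q - p) * (Real.exp (-p) * (M ^ n / a)) := by
    intro p q hpq hp hq h
    refine integral_exp_neg_mul_le hg hpq fun x hx => ?_
    have h3 : Real.exp (-x) * |hermiteEval m n k x| ≤ Real.exp (-p) * (M ^ n / a) :=
      mul_le_mul (Real.exp_le_exp.2 (by linarith [hx.1]))
        (abs_hermiteEval_le_div hk hn ha (h x hx.1 hx.2)
          (hM x (hp.trans hx.1) (hx.2.trans hq))) (abs_nonneg _) (Real.exp_pos _).le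
    -- The superfluous e^(-x) A is added on the peak intervals too, so that the A-terms of all five
    -- pieces telescope to A (1 - e^(-m)) ≤ A.
    have h4 : 0 ≤ Real.exp (-x) * A := by positivity
    linarith
  have hint : ∀ p q : ℝ, IntervalIntegrable
      (fun x => Real.exp (-x) * |hermiteEval m n k x|) volume p q :=
    fun p q => Continuous.intervalIntegrable (by fun_prop) _ _
  have hexpm := Real.exp_pos (-(m : ℝ))
  have i1 := outer 0 a ha.le le_rfl (by linarith) h0
  have i2 := inner a b hab ha.le (by linarith) fun x hx hx' => hfar x (Or.inl ⟨hx, hx'⟩)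
  have i3 := outer b (m - b) hb2 (by linarith) (by linarith) h1
  have i4 := inner (m - b) (m - a) (by linarith) (by linarith) (by linarith)
    fun x hx hx' => hfar x (Or.inr ⟨hx, hx'⟩)
  have i5 := outer (m - a) m (by linarith) (by linarith) le_rfl h2
  rw [← intervalIntegral.integral_add_adjacent_intervals (hint 0 a) (hint a m),
    ← intervalIntegral.integral_add_adjacent_intervals (hint a b) (hint b m),
    ← intervalIntegral.integral_add_adjacent_intervals (hint b (m - b)) (hint (m - b) m),
    ← intervalIntegral.integral_add_adjacent_intervals (hint (m - b) (m - a)) (hint (m - a) m)]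
  rw [neg_zero, Real.exp_zero] at i1
  have h5 : 0 ≤ A * Real.exp (-(m : ℝ)) := by positivity
  nlinarith

end ExpMeasure

end

/-! ### Maxima of the distance product for m = 2, 3, 4, 5 -/

noncomputable section

namespace ExpMeasure

theorem nodeProd_two (x : ℝ) : nodeProd 2 x = |x * (x - 1) * (x - 2)| := by
  simp [nodeProd, Finset.prod_range_succ, abs_mul]

theorem nodeProd_three (x : ℝ) : nodeProd 3 x = |x * (x - 1) * (x - 2) * (x - 3)| := by
  simp [nodeProd, Finset.prod_range_succ, abs_mul]

theorem nodeProd_four (x : ℝ) :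
    nodeProd 4 x = |x * (x - 1) * (x - 2) * (x - 3) * (x - 4)| := by
  simp [nodeProd, Finset.prod_range_succ, abs_mul]

theorem nodeProd_five (x : ℝ) :
    nodeProd 5 x = |x * (x - 1) * (x - 2) * (x - 3) * (x - 4) * (x - 5)| := by
  simp [nodeProd, Finset.prod_range_succ, abs_mul]

theorem nodeProd_two_le {x : ℝ} (h0 : 0 ≤ x) (h2 : x ≤ 2) : nodeProd 2 x ≤ 0.385 := by
  rw [nodeProd_two]
  refine abs_le_of_sq_le_sq ?_ (by norm_num)
  obtain ⟨t, ht⟩ : ∃ t, t = (x - 1) ^ 2 := ⟨_, rfl⟩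
  have ht0 : 0 ≤ t := by rw [ht]; positivity
  have ht1 : t ≤ 1 := by rw [ht]; nlinarith
  have h : (x * (x - 1) * (x - 2)) ^ 2 = t * (1 - t) ^ 2 := by rw [ht]; ring
  rw [h]
  -- The maximum is at t = 1/3, and 0.385² exceeds 4/27.
  have : 4 / 27 - t * (1 - t) ^ 2 = (4 / 3 - t) * (t - 1 / 3) ^ 2 := by ring
  have : 0 ≤ (4 / 3 - t) * (t - 1 / 3) ^ 2 := mul_nonneg (by linarith) (sq_nonneg _)
  norm_num
  linarith

/-- In y = x(x - 3) the product is y(y + 2) = (y + 1)² - 1, with y in [-9/4, 0]. -/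
theorem nodeProd_three_le {x : ℝ} (h0 : 0 ≤ x) (h3 : x ≤ 3) : nodeProd 3 x ≤ 1 := by
  rw [nodeProd_three]
  have h : x * (x - 1) * (x - 2) * (x - 3) = (x * (x - 3) + 1) ^ 2 - 1 := by ring
  have h1 : x * (x - 3) ≤ 0 := by nlinarith
  have h2 : -9 / 4 ≤ x * (x - 3) := by nlinarith [sq_nonneg (x - 3 / 2)]
  rw [h, abs_le]
  constructor <;> nlinarith

/-- The value -0.6875 is x(x - 3) at x = 0.25, the left end of the peak interval; -1.3475 below is
its value at the right end x = 0.55. -/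
theorem nodeProd_three_le_of_edge {x : ℝ} (h1 : -0.6875 ≤ x * (x - 3)) (h2 : x * (x - 3) ≤ 0) :
    nodeProd 3 x ≤ 0.9024 := by
  rw [nodeProd_three]
  have h : x * (x - 1) * (x - 2) * (x - 3) = (x * (x - 3) + 1) ^ 2 - 1 := by ring
  rw [h, abs_le]
  constructor <;> nlinarith

theorem nodeProd_three_le_of_middle {x : ℝ} (h1 : x * (x - 3) ≤ -1.3475) :
    nodeProd 3 x ≤ 0.9024 := by
  rw [nodeProd_three]
  have h2 : -9 / 4 ≤ x * (x - 3) := by nlinarith [sq_nonneg (x - 3 / 2)]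
  have h : x * (x - 1) * (x - 2) * (x - 3) = (x * (x - 3) + 1) ^ 2 - 1 := by ring
  rw [h, abs_le]
  constructor <;> nlinarith

theorem nodeProd_four_eq (x : ℝ) :
    nodeProd 4 x = |(|x - 2| ^ 5 - 5 * |x - 2| ^ 3 + 4 * |x - 2|)| := by
  rw [nodeProd_four]
  rcases abs_cases (x - 2) with ⟨h, _⟩ | ⟨h, _⟩
  · rw [h]
    congr 1
    ring
  · rw [h, ← abs_neg]
    congr 1
    ring

theorem quintic_le {w : ℝ} (h0 : 0 ≤ w) (h2 : w ≤ 2) : w ^ 5 - 5 * w ^ 3 + 4 * w ≤ 3.6 := by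
  have h3 : 0 ≤ w ^ 3 * (4 - w ^ 2) := mul_nonneg (by positivity) (by nlinarith)
  have h4 : -w ^ 3 + 4 * w ≤ 3.6 := by
    nlinarith [mul_nonneg h0 (sq_nonneg (w - 1.1547)), sq_nonneg (w - 1.1547)]
  nlinarith

theorem neg_le_quintic {w : ℝ} (h0 : 0 ≤ w) :
    -3.63144 ≤ w ^ 5 - 5 * w ^ 3 + 4 * w := by
  -- 1.64443 approximates the minimiser of the quintic; the cubic is the rounded quotient by the
  -- corresponding double root.
  have h2 : 0 ≤ (w - 1.64443) ^ 2 * (w ^ 3 + 3.28886 * w ^ 2 + 3.11 * w + 1.33) := by positivity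
  have h3 : 0 ≤ (w - 1.64443) ^ 2 * w := by positivity
  nlinarith [sq_nonneg (w - 1.648)]

theorem neg_le_quintic_of_le {w : ℝ} (h0 : 0 ≤ w) (h1 : w ≤ 1.618) :
    -3.6203 ≤ w ^ 5 - 5 * w ^ 3 + 4 * w := by
  have h2 : w ^ 5 - 5 * w ^ 3 + 4 * w + 3.6203 = (w - 1.618) * (w ^ 4 + 1.618 * w ^ 3
      - 2.382076 * w ^ 2 - 3.854198968 * w - 2.236093930224) + 0.002300020897568 := by ring
  have h3 : w ^ 4 + 1.618 * w ^ 3 - 2.382076 * w ^ 2 - 3.854198968 * w - 2.236093930224 ≤ 0 := by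
    have h4 : w ^ 4 + 1.618 * w ^ 3 ≤ 5.3 * w ^ 2 := by
      have h5 : 0 ≤ w ^ 2 * (1.618 - w) := mul_nonneg (sq_nonneg w) (by linarith)
      have h6 : 0 ≤ w * (w ^ 2 * (1.618 - w)) := mul_nonneg h0 h5
      nlinarith
    nlinarith
  nlinarith

theorem neg_le_quintic_of_ge {w : ℝ} (h0 : 1.67 ≤ w) :
    -3.6203 ≤ w ^ 5 - 5 * w ^ 3 + 4 * w := by
  obtain ⟨v, hv, rfl⟩ : ∃ v, 0 ≤ v ∧ w = v + 1.67 := ⟨w - 1.67, by linarith, by ring⟩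
  have : 0 ≤ v ^ 5 + 8.35 * v ^ 4 + 22.889 * v ^ 3 + 21.5 * v ^ 2 + 1.05 * v := by positivity
  nlinarith

theorem abs_sub_two_le {x : ℝ} (h0 : 0 ≤ x) (h4 : x ≤ 4) : |x - 2| ≤ 2 := by
  rw [abs_le]; constructor <;> linarith

theorem nodeProd_four_le {x : ℝ} (h0 : 0 ≤ x) (h4 : x ≤ 4) : nodeProd 4 x ≤ 3.63144 := by
  rw [nodeProd_four_eq, abs_le]
  have h1 := quintic_le (abs_nonneg _) (abs_sub_two_le h0 h4)
  exact ⟨neg_le_quintic (abs_nonneg _), by linarith⟩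

theorem nodeProd_four_le_of_edge {x : ℝ} (h0 : 0 ≤ x) (h4 : x ≤ 4) (h : 1.67 ≤ |x - 2|) :
    nodeProd 4 x ≤ 3.6203 := by
  rw [nodeProd_four_eq, abs_le]
  have h1 := quintic_le (abs_nonneg _) (abs_sub_two_le h0 h4)
  exact ⟨neg_le_quintic_of_ge h, by linarith⟩

theorem nodeProd_four_le_of_middle {x : ℝ} (h : |x - 2| ≤ 1.618) :
    nodeProd 4 x ≤ 3.6203 := by
  rw [nodeProd_four_eq, abs_le]
  have h1 := quintic_le (abs_nonneg _) (show |x - 2| ≤ 2 by linarith)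
  exact ⟨neg_le_quintic_of_le (abs_nonneg _) h, by linarith⟩

theorem nodeProd_five_le {x : ℝ} (h0 : 0 ≤ x) (h5 : x ≤ 5) : nodeProd 5 x ≤ 16.902 := by
  rw [nodeProd_five]
  obtain ⟨t, ht⟩ : ∃ t, t = (x - 5 / 2) ^ 2 := ⟨_, rfl⟩
  have ht0 : 0 ≤ t := by rw [ht]; positivity
  have ht1 : t ≤ 25 / 4 := by rw [ht]; nlinarith
  have h : x * (x - 1) * (x - 2) * (x - 3) * (x - 4) * (x - 5) =
      t ^ 3 - 8.75 * t ^ 2 + 16.1875 * t - 3.515625 := by rw [ht]; ring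
  rw [h, abs_le]
  constructor
  · have h2 : 0 ≤ (t - 4.6805) ^ 2 * (t + 0.611) := by positivity
    nlinarith
  · nlinarith [mul_nonneg ht0 (sq_nonneg (t - 2)), mul_nonneg ht0 (sub_nonneg.2 ht1),
      mul_nonneg (mul_nonneg ht0 ht0) (sub_nonneg.2 ht1)]

end ExpMeasure

end

/-! ### The degrees m = 2, 3, 4 -/

noncomputable section

namespace ExpMeasure

theorem smallPrimes_two : smallPrimes 2 = ∅ := by decide

theorem smallPrimes_three : smallPrimes 3 = {2} := by decide

theorem smallPrimes_four : smallPrimes 4 = {2} := by decide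

theorem minFloor_three_two : minFloor 3 2 = 1 := by decide

theorem minFloor_four_two : minFloor 4 2 = 1 := by decide

theorem primeWeight_two : primeWeight 2 = 0 := by simp [primeWeight, smallPrimes_two]

theorem primeCount_two : primeCount 2 = 0 := by simp [primeCount, smallPrimes_two]

theorem primeWeight_three : primeWeight 3 = Real.log 2 := by
  simp [primeWeight, smallPrimes_three, minFloor_three_two]
  norm_num

theorem primeCount_three : primeCount 3 = 1 := by
  simp [primeCount, smallPrimes_three, minFloor_three_two]

theorem primeWeight_four : primeWeight 4 = Real.log 2 := by
  simp [primeWeight, smallPrimes_four, minFloor_four_two]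
  norm_num

theorem primeCount_four : primeCount 4 = 1 := by
  simp [primeCount, smallPrimes_four, minFloor_four_two]

/-- The tangent line of log at a. It is used with a a product of powers of 2, 3 and 5, whose
logarithm is known numerically. -/
theorem log_le_log_add {a x : ℝ} (ha : 0 < a) (hx : 0 < x) :
    Real.log x ≤ Real.log a + x / a - 1 := by
  have h := Real.log_le_sub_one_of_pos (div_pos hx ha)
  rw [Real.log_div hx.ne' ha.ne'] at h
  linarith

theorem log_two_pow_mul_three_pow_mul_five_pow (a b c : ℤ) :
    Real.log ((2 : ℝ) ^ a * 3 ^ b * 5 ^ c) = a * Real.log 2 + b * Real.log 3 + c * Real.log 5 := by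
  rw [Real.log_mul (by positivity) (by positivity), Real.log_mul (by positivity) (by positivity),
    Real.log_zpow, Real.log_zpow, Real.log_zpow]

theorem exp_add_one_eq_pow (j : ℕ) : Real.exp ((j : ℝ) + 1) = Real.exp 1 ^ (j + 1) := by
  rw [← Real.exp_nat_mul]
  push_cast
  rw [mul_one]

theorem log_two_mul_ge {H t : ℝ} (hH : 0 < H) (ht : t ≤ Real.log H) :
    0.6931471803 + t ≤ Real.log (2 * H) := by
  rw [Real.log_mul two_ne_zero hH.ne']
  linarith [Real.log_two_gt_d9]

theorem sum_exp_three_le : (∑ j ∈ Finset.range 3, Real.exp ((j : ℝ) + 1)) ≤ 30.2 := by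
  have e1' := Real.exp_one_lt_d9
  simp only [exp_add_one_eq_pow, Finset.sum_range_succ, Finset.sum_range_zero]
  have h2 : Real.exp 1 ^ 2 ≤ 2.7182818286 ^ 2 := by gcongr
  have h3 : Real.exp 1 ^ 3 ≤ 2.7182818286 ^ 3 := by gcongr
  norm_num at h2 h3 e1' ⊢
  linarith

theorem sum_exp_four_le : (∑ j ∈ Finset.range 4, Real.exp ((j : ℝ) + 1)) ≤ 84.8 := by
  have e1' := Real.exp_one_lt_d9
  simp only [exp_add_one_eq_pow, Finset.sum_range_succ, Finset.sum_range_zero]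
  have h2 : Real.exp 1 ^ 2 ≤ 2.7182818286 ^ 2 := by gcongr
  have h3 : Real.exp 1 ^ 3 ≤ 2.7182818286 ^ 3 := by gcongr
  have h4 : Real.exp 1 ^ 4 ≤ 2.7182818286 ^ 4 := by gcongr
  norm_num at h2 h3 h4 e1' ⊢
  linarith

/-- The peak value is 1, so the integral is bounded by a constant; outside the peaks 0.9024^41
already outweighs the factor 27. -/
theorem remainder_three_le {n : ℕ} (hn : 42 ≤ n) :
    (∑ j ∈ Finset.range 3, Real.exp ((j : ℝ) + 1)) *
      ((0.55 - 0.25) * (Real.exp (-0.25) + Real.exp (-(((3 : ℕ) : ℝ) - 0.55))) *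
        (1 ^ n / 0.25) + ((3 : ℕ) : ℝ) ^ 3 * 0.9024 ^ (n - 1)) ≤ Real.exp 3.81 := by
  have l2 := Real.log_two_gt_d9
  have l3' := Real.log_three_lt_d9
  have l5' := Real.log_five_lt_d9
  have log45 : Real.log 45 = 2 * Real.log 3 + Real.log 5 := by
    have := log_two_pow_mul_three_pow_mul_five_pow 0 2 1
    norm_num at this ⊢; linarith
  have log11 : Real.log 11.25 = 2 * Real.log 3 + Real.log 5 - 2 * Real.log 2 := by
    have := log_two_pow_mul_three_pow_mul_five_pow (-2) 2 1
    norm_num at this ⊢; linarith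
  have h2 : (45 : ℝ) ≤ Real.exp 3.81 := by
    rw [← Real.log_le_iff_le_exp (by norm_num), log45]; linarith
  have h3 : Real.exp (-0.25) ≤ 0.78 := by
    rw [Real.exp_neg]
    have h4 : (0.78 : ℝ)⁻¹ ≤ Real.exp 0.25 := by
      have h5 := Real.sum_le_exp_of_nonneg (show (0 : ℝ) ≤ 0.25 by norm_num) 4
      norm_num [Finset.sum_range_succ, Nat.factorial] at h5 ⊢
      linarith
    exact inv_le_of_inv_le₀ (by norm_num) h4
  have h4 : Real.exp (-(((3 : ℕ) : ℝ) - 0.55)) ≤ 0.089 := by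
    rw [Real.exp_neg]
    have h5 : (11.25 : ℝ) ≤ Real.exp (((3 : ℕ) : ℝ) - 0.55) := by
      rw [← Real.log_le_iff_le_exp (by norm_num), log11]
      push_cast; linarith
    exact inv_le_of_inv_le₀ (by norm_num) (le_trans (by norm_num) h5)
  have h5 : (0.9024 : ℝ) ^ (n - 1) ≤ 0.9024 ^ 41 :=
    pow_le_pow_of_le_one (by norm_num) (by norm_num) (by omega)
  have h6 : (0.9024 : ℝ) ^ 41 ≤ 0.0149 := by norm_num
  calc _ ≤ (30.2 : ℝ) * ((0.55 - 0.25) * (0.78 + 0.089) * (1 ^ n / 0.25) +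
        ((3 : ℕ) : ℝ) ^ 3 * 0.0149) := by
        refine mul_le_mul sum_exp_three_le (add_le_add (mul_le_mul_of_nonneg_right
          (mul_le_mul_of_nonneg_left (add_le_add h3 h4) (by norm_num)) (by positivity))
          (mul_le_mul_of_nonneg_left (h5.trans h6) (by positivity))) ?_ (by norm_num)
        exact add_nonneg (mul_nonneg (mul_nonneg (by norm_num) (by positivity)) (by positivity))
          (by positivity)
    _ ≤ 45 := by rw [one_pow]; norm_num
    _ ≤ _ := h2

theorem log_peak_four_le : Real.log 3.63144 ≤ 1.28964 := by
  have l2 := Real.log_two_gt_d9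
  have l3' := Real.log_three_lt_d9
  have l5 := Real.log_five_gt_d9
  have h1 := log_two_pow_mul_three_pow_mul_five_pow (-3) 6 (-2)
  have h2 := log_le_log_add (show (0 : ℝ) < 3.645 by norm_num)
    (show (0 : ℝ) < 3.63144 by norm_num)
  norm_num at h1 h2 ⊢
  linarith

theorem remainder_four_le {n : ℕ} (hn : 2661 ≤ n) :
    (∑ j ∈ Finset.range 4, Real.exp ((j : ℝ) + 1)) *
      ((0.382 - 0.33) * (Real.exp (-0.33) + Real.exp (-(((4 : ℕ) : ℝ) - 0.382))) *
        (3.63144 ^ n / 0.33) + ((4 : ℕ) : ℝ) ^ 4 * 3.6203 ^ (n - 1)) ≤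
      Real.exp (2.485 + 1.28964 * n) := by
  have l2 := Real.log_two_gt_d9
  have l2' := Real.log_two_lt_d9
  have l3' := Real.log_three_lt_d9
  have l5 := Real.log_five_gt_d9
  have log36 : Real.log 36.45 = 6 * Real.log 3 - 2 * Real.log 2 - Real.log 5 := by
    have := log_two_pow_mul_three_pow_mul_five_pow (-2) 6 (-1)
    norm_num at this ⊢; linarith
  have log3456 : Real.log 3456 = 7 * Real.log 2 + 3 * Real.log 3 := by
    have := log_two_pow_mul_three_pow_mul_five_pow 7 3 0
    norm_num at this ⊢; linarith
  have log12 : Real.log 12 = 2 * Real.log 2 + Real.log 3 := by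
    have := log_two_pow_mul_three_pow_mul_five_pow 2 1 0
    norm_num at this ⊢; linarith
  obtain ⟨n, rfl⟩ : ∃ n', n = n' + 1 := ⟨n - 1, by omega⟩
  have h2660 : (2660 : ℝ) ≤ n := by exact_mod_cast Nat.lt_succ_iff.1 hn
  have h2 : (12 : ℝ) ≤ Real.exp 2.485 := by
    rw [← Real.log_le_iff_le_exp (by norm_num), log12]; linarith
  have h3 : Real.exp (-0.33) ≤ 0.72 := by
    rw [Real.exp_neg]
    have h4 : (0.72 : ℝ)⁻¹ ≤ Real.exp 0.33 := by
      have h5 := Real.sum_le_exp_of_nonneg (show (0 : ℝ) ≤ 0.33 by norm_num) 5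
      norm_num [Finset.sum_range_succ, Nat.factorial] at h5 ⊢
      linarith
    exact inv_le_of_inv_le₀ (by norm_num) h4
  have h4 : Real.exp (-(((4 : ℕ) : ℝ) - 0.382)) ≤ 0.0275 := by
    rw [Real.exp_neg]
    have h5 : (36.45 : ℝ) ≤ Real.exp (((4 : ℕ) : ℝ) - 0.382) := by
      rw [← Real.log_le_iff_le_exp (by norm_num), log36]
      push_cast; linarith
    exact inv_le_of_inv_le₀ (by norm_num) (le_trans (by norm_num) h5)
  have h5 : (3.6203 : ℝ) ^ n ≤ 3.63144 ^ n * (1 / 3456) := by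
    -- The ratio of off-peak to peak value is at most e^(-0.003067); its 2660th power falls below
    -- 1/3456.
    have h6 : (3.6203 : ℝ) ≤ 3.63144 * Real.exp (-0.003067) := by
      have := Real.add_one_le_exp (-0.003067 : ℝ)
      linarith
    have h7 : Real.exp (-0.003067) ^ n ≤ 1 / 3456 := by
      rw [← Real.exp_nat_mul, one_div, ← Real.exp_log (show (0 : ℝ) < 3456 by norm_num),
        ← Real.exp_neg, log3456]
      exact Real.exp_le_exp.2 (by linarith)
    calc (3.6203 : ℝ) ^ n ≤ (3.63144 * Real.exp (-0.003067)) ^ n := by gcongr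
      _ = 3.63144 ^ n * Real.exp (-0.003067) ^ n := mul_pow _ _ _
      _ ≤ _ := by gcongr
  have h8 : (3.63144 : ℝ) ^ (n + 1) ≤ Real.exp (1.28964 * (n + 1 : ℕ)) := by
    rw [mul_comm, Real.exp_nat_mul]
    exact pow_le_pow_left₀ (by norm_num)
      ((Real.log_le_iff_le_exp (by norm_num)).1 log_peak_four_le) _
  have h9 : (0 : ℝ) ≤ 3.63144 ^ n := by positivity
  rw [Real.exp_add]
  calc _ ≤ (84.8 : ℝ) * ((0.382 - 0.33) * (0.72 + 0.0275) * (3.63144 ^ (n + 1) / 0.33) +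
        ((4 : ℕ) : ℝ) ^ 4 * (3.63144 ^ n * (1 / 3456))) := by
        refine mul_le_mul sum_exp_four_le (add_le_add (mul_le_mul_of_nonneg_right
          (mul_le_mul_of_nonneg_left (add_le_add h3 h4) (by norm_num)) (by positivity))
          (mul_le_mul_of_nonneg_left h5 (by positivity))) ?_ (by norm_num)
        exact add_nonneg (mul_nonneg (mul_nonneg (by norm_num) (by positivity)) (by positivity))
          (by positivity)
    _ ≤ 12 * 3.63144 ^ (n + 1) := by
        rw [pow_succ (3.63144 : ℝ)]
        generalize (3.63144 : ℝ) ^ n = y at h9 ⊢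
        push_cast
        norm_num
        linarith
    _ ≤ _ := by gcongr

section SmallDegrees

variable (K : Type*) [Field K] [NumberField K] [Algebra.IsQuadraticExtension ℚ K]
  [NumberField.IsTotallyComplex K] (σ : K →+* ℂ) {H : ℝ}

theorem linear_form_bound_two (hH : 0 < H)
    (hlog : s 2 * Real.exp (s 2) ≤ Real.log H) (lam : Fin (2 + 1) → NumberField.RingOfIntegers K)
    (hlam : lam ≠ 0) (hbound : ∀ j : Fin (2 + 1), 1 ≤ (j : ℕ) → ‖σ (lam j : K)‖ ≤ H) :
    1 / (2 * Real.exp (D 2)) * ((s 2 - d 2) / (s 2 + Real.log (s 2)) *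
        (Real.log (Real.log (2 * H)) / Real.log (2 * H))) ^ 2 *
        (2 * H) ^ (-((2 : ℕ) : ℝ) - Bhat 2 / Real.log (Real.log (2 * H))) ≤
      ‖∑ j : Fin (2 + 1), σ (lam j : K) * Complex.exp 1 ^ (j : ℕ)‖ := by
  have l2 := Real.log_two_gt_d9
  have l2' := Real.log_two_lt_d9
  have l3' := Real.log_three_lt_d9
  have l5 := Real.log_five_gt_d9
  have e1 := Real.exp_one_gt_d9
  have e1' := Real.exp_one_lt_d9
  have hs : s 2 = Real.exp 1 := by simp [s]
  have hd : d 2 = 0.3654 := by simp [d]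
  have hB : B 2 = 2.4099 := by simp [B]
  have hD : D 2 = 3.8111 := by simp [D]
  have log16 : Real.log 16 = 4 * Real.log 2 := by
    have := log_two_pow_mul_three_pow_mul_five_pow 4 0 0
    norm_num at this; linarith
  have log14 : Real.log 14.4 = 3 * Real.log 2 + 2 * Real.log 3 - Real.log 5 := by
    have := log_two_pow_mul_three_pow_mul_five_pow 3 2 (-1)
    norm_num at this ⊢; linarith
  have log108 : Real.log 108 = 2 * Real.log 2 + 3 * Real.log 3 := by
    have := log_two_pow_mul_three_pow_mul_five_pow 2 3 0
    norm_num at this ⊢; linarith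
  have logM : Real.log 0.385 ≤ -0.954 := by
    have h1 := log_two_pow_mul_three_pow_mul_five_pow 4 1 (-3)
    have h2 := log_le_log_add (show (0 : ℝ) < 0.384 by norm_num) (show (0 : ℝ) < 0.385 by norm_num)
    norm_num at h1 h2 ⊢
    linarith
  -- x₀ = 16 lies slightly above e^e, and 4.7 - 0.954 n comes from the peak value 0.385.
  refine linear_form_lower_bound K σ hH lam hlam hbound (s := s 2) (d := d 2) (c := d 2)
    (B := B 2) (D := D 2) (γ := 0) (x₀ := 16) (J := fun n => ((2 : ℕ) : ℝ) ^ 2 * 0.385 ^ (n - 1))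
    (τ := fun n => 4.7 - 0.954 * n) hs.ge ?_ le_rfl ?_ ?_ ?_ ?_ ?_ ?_ ?_ ?_ ?_ ?_
  · rw [hd]; norm_num
  · rw [hd, hs]; norm_num; linarith
  · rw [hB]; norm_num
  · rw [hB, hd]; norm_num
  · rw [hB, hd, hD]; norm_num
  · rw [hs, ← Real.le_log_iff_exp_le (by norm_num), log16]
    linarith
  · have h1 := log_two_mul_ge hH hlog
    have h2 : (14.4 : ℝ) ≤ Real.exp (Real.exp 1) := by
      rw [← Real.log_le_iff_le_exp (by norm_num), log14]
      linarith
    rw [hs] at h1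
    rw [hd, log16]
    have h3 : (2.7182818283 : ℝ) * 14.4 ≤ Real.exp 1 * Real.exp (Real.exp 1) := by gcongr
    linarith
  · intro n hn k hk
    have hn1 : 1 ≤ n := by
      have : (1 : ℝ) ≤ n := by linarith
      exact_mod_cast this
    exact integral_hermite_le hk hn1 (by norm_num) fun x h0 h2 =>
      nodeProd_two_le h0 (by exact_mod_cast h2)
  · intro n hn
    obtain ⟨n, rfl⟩ : ∃ n', n = n' + 1 := ⟨n - 1, by
      have : (1 : ℝ) ≤ n := by linarith
      have : 1 ≤ n := by exact_mod_cast this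
      omega⟩
    have h1 : (∑ j ∈ Finset.range 2, Real.exp ((j : ℝ) + 1)) ≤ 10.2 := by
      simp only [exp_add_one_eq_pow, Finset.sum_range_succ, Finset.sum_range_zero]
      nlinarith
    have h2 : (108 : ℝ) ≤ Real.exp 4.7 := by
      rw [← Real.log_le_iff_le_exp (by norm_num), log108]; linarith
    have h3 : (0.385 : ℝ) ^ (n + 1) ≤ Real.exp (-0.954 * (n + 1 : ℕ)) := by
      rw [mul_comm, Real.exp_nat_mul]
      refine pow_le_pow_left₀ (by norm_num) ?_ _
      exact (Real.log_le_iff_le_exp (by norm_num)).1 logM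
    have h4 : Real.exp (4.7 - 0.954 * (n + 1 : ℕ)) =
        Real.exp 4.7 * Real.exp (-0.954 * (n + 1 : ℕ)) := by
      rw [← Real.exp_add]; congr 1; ring
    rw [h4]
    have h5 : (0 : ℝ) ≤ 0.385 ^ n := by positivity
    calc _ ≤ 10.2 * (((2 : ℕ) : ℝ) ^ 2 * 0.385 ^ n) := by
          simp only [Nat.add_sub_cancel]
          gcongr
      _ ≤ 108 * 0.385 ^ (n + 1) := by rw [pow_succ (0.385 : ℝ)]; push_cast; linarith
      _ ≤ _ := by gcongr
  · intro n hn
    have h1 := log_le_log_add (show (0 : ℝ) < 16 by norm_num)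
      (show (0 : ℝ) < n by linarith)
    have h17 : (17 : ℝ) ≤ n := by
      have : 16 < n := by exact_mod_cast hn
      exact_mod_cast this
    rw [log16] at h1
    rw [primeWeight_two, primeCount_two, hd]
    linarith
  · intro n hn
    rw [primeWeight_two, primeCount_two, hd, hB, show (((2 : ℕ) : ℝ) + 1) = 3 by norm_num]
    have h1 := mul_le_mul_of_nonneg_right l3'.le (Nat.cast_nonneg (α := ℝ) n)
    push_cast
    linarith

theorem linear_form_bound_three (hH : 0 < H)
    (hlog : s 3 * Real.exp (s 3) ≤ Real.log H) (lam : Fin (3 + 1) → NumberField.RingOfIntegers K)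
    (hlam : lam ≠ 0) (hbound : ∀ j : Fin (3 + 1), 1 ≤ (j : ℕ) → ‖σ (lam j : K)‖ ≤ H) :
    1 / (2 * Real.exp (D 3)) * ((s 3 - d 3) / (s 3 + Real.log (s 3)) *
        (Real.log (Real.log (2 * H)) / Real.log (2 * H))) ^ 3 *
        (2 * H) ^ (-((3 : ℕ) : ℝ) - Bhat 3 / Real.log (Real.log (2 * H))) ≤
      ‖∑ j : Fin (3 + 1), σ (lam j : K) * Complex.exp 1 ^ (j : ℕ)‖ := by
  have l2 := Real.log_two_gt_d9
  have l2' := Real.log_two_lt_d9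
  have l3 := Real.log_three_gt_d9
  have l3' := Real.log_three_lt_d9
  have l5 := Real.log_five_gt_d9
  have e1' := Real.exp_one_lt_d9
  have hs : s 3 = 3 * Real.log 3 ^ 2 := by simp [s]
  have hs1 : 3.62 ≤ s 3 := by rw [hs]; nlinarith
  have hs2 : s 3 ≤ 3.621 := by rw [hs]; nlinarith
  have hd : d 3 = 0.5139 := by simp [d]
  have hB : B 3 = 3.6433 := by simp [B]
  have hD : D 3 = 5.1819 := by simp [D]
  have log40 : Real.log 40.5 = 4 * Real.log 3 - Real.log 2 := by
    have := log_two_pow_mul_three_pow_mul_five_pow (-1) 4 0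
    norm_num at this ⊢; linarith
  have log36 : Real.log 36.45 = 6 * Real.log 3 - 2 * Real.log 2 - Real.log 5 := by
    have := log_two_pow_mul_three_pow_mul_five_pow (-2) 6 (-1)
    norm_num at this ⊢; linarith
  have log43 : Real.log 43.2 = 3 * Real.log 2 + 3 * Real.log 3 - Real.log 5 := by
    have := log_two_pow_mul_three_pow_mul_five_pow 3 3 (-1)
    norm_num at this ⊢; linarith
  have log4 : Real.log 4 = 2 * Real.log 2 := Real.log_four_eq
  refine linear_form_lower_bound K σ hH lam hlam hbound (s := s 3) (d := d 3) (c := d 3)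
    (B := B 3) (D := D 3) (γ := 0) (x₀ := 41)
    (J := fun n => (0.55 - 0.25) * (Real.exp (-0.25) + Real.exp (-(((3 : ℕ) : ℝ) - 0.55))) *
      (1 ^ n / 0.25) + ((3 : ℕ) : ℝ) ^ 3 * 0.9024 ^ (n - 1))
    (τ := fun _ => 3.81) (by linarith) ?_ le_rfl ?_ ?_ ?_ ?_ ?_ ?_ ?_ ?_ ?_ ?_
  · rw [hd]; norm_num
  · rw [hd]; norm_num; linarith
  · rw [hB]; norm_num
  · rw [hB, hd]; norm_num
  · rw [hB, hd, hD]; norm_num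
  · have h1 : s 3 ≤ Real.log 40.5 := by rw [log40]; linarith
    have h2 := (Real.le_log_iff_exp_le (by norm_num)).1 h1
    linarith
  · have h1 := log_two_mul_ge hH hlog
    have h2 : (36.45 : ℝ) ≤ Real.exp (s 3) := by
      rw [← Real.log_le_iff_le_exp (by norm_num), log36]
      linarith
    have h3 : (3.62 : ℝ) * 36.45 ≤ s 3 * Real.exp (s 3) := by gcongr
    have h4 := log_le_log_add (show (0 : ℝ) < 40.5 by norm_num) (show (0 : ℝ) < 41 by norm_num)
    rw [log40] at h4
    rw [hd]
    linarith
  · intro n hn k hk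
    have hn1 : 1 ≤ n := by
      have : (1 : ℝ) ≤ n := by linarith
      exact_mod_cast this
    refine integral_hermite_le_of_peaks hk hn1 (by norm_num) (by norm_num) (by norm_num)
      (by norm_num) (by norm_num) (fun x h0 h3 => nodeProd_three_le h0 (by exact_mod_cast h3))
      (fun x h0 h1 => nodeProd_three_le_of_edge ?_ ?_)
      (fun x h0 h1 => nodeProd_three_le_of_middle ?_)
      (fun x h0 h1 => nodeProd_three_le_of_edge ?_ ?_)
    all_goals norm_num at h0 h1 ⊢
    all_goals nlinarith
  · intro n hn
    refine remainder_three_le ?_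
    have : 41 < n := by exact_mod_cast hn
    exact this
  · intro n hn
    have h1 := log_le_log_add (show (0 : ℝ) < 40.5 by norm_num) (show (0 : ℝ) < n by linarith)
    have h2 := log_le_log_add (show (0 : ℝ) < 43.2 by norm_num)
      (show (0 : ℝ) < (n : ℝ) + 1 by linarith)
    have h42 : (42 : ℝ) ≤ n := by
      have : 41 < n := by exact_mod_cast hn
      exact_mod_cast this
    rw [log40] at h1
    rw [log43] at h2
    norm_num at h1 h2
    rw [primeWeight_three, primeCount_three, hd]
    have h3 := mul_le_mul_of_nonneg_right l2.le (Nat.cast_nonneg (α := ℝ) n)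
    linarith
  · intro n hn
    have h2 := log_le_log_add (show (0 : ℝ) < 43.2 by norm_num)
      (show (0 : ℝ) < (n : ℝ) + 1 by linarith)
    rw [log43] at h2
    norm_num at h2
    rw [primeWeight_three, primeCount_three, hd, hB]
    rw [show (((3 : ℕ) : ℝ) + 1) = 4 by norm_num, log4]
    have h3 := mul_le_mul_of_nonneg_right l2'.le (Nat.cast_nonneg (α := ℝ) n)
    push_cast
    linarith

theorem linear_form_bound_four (hH : 0 < H)
    (hlog : s 4 * Real.exp (s 4) ≤ Real.log H) (lam : Fin (4 + 1) → NumberField.RingOfIntegers K)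
    (hlam : lam ≠ 0) (hbound : ∀ j : Fin (4 + 1), 1 ≤ (j : ℕ) → ‖σ (lam j : K)‖ ≤ H) :
    1 / (2 * Real.exp (D 4)) * ((s 4 - d 4) / (s 4 + Real.log (s 4)) *
        (Real.log (Real.log (2 * H)) / Real.log (2 * H))) ^ 4 *
        (2 * H) ^ (-((4 : ℕ) : ℝ) - Bhat 4 / Real.log (Real.log (2 * H))) ≤
      ‖∑ j : Fin (4 + 1), σ (lam j : K) * Complex.exp 1 ^ (j : ℕ)‖ := by
  have l2 := Real.log_two_gt_d9
  have l2' := Real.log_two_lt_d9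
  have l3 := Real.log_three_gt_d9
  have l3' := Real.log_three_lt_d9
  have l5' := Real.log_five_lt_d9
  have e1' := Real.exp_one_lt_d9
  have hs : s 4 = 16 * Real.log 2 ^ 2 := by
    simp only [s, Nat.cast_ofNat, Real.log_four_eq]
    norm_num; ring
  have hs1 : 7.6872 ≤ s 4 := by rw [hs]; nlinarith
  have hs2 : s 4 ≤ 7.6873 := by rw [hs]; nlinarith
  have hd : d 4 = 1.6016 := by simp [d]
  have hB : B 4 = 9.7676 := by simp [B]
  have hD : D 4 = 7.3631 := by simp [D]
  have log2592 : Real.log 2592 = 5 * Real.log 2 + 4 * Real.log 3 := by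
    have := log_two_pow_mul_three_pow_mul_five_pow 5 4 0
    norm_num at this ⊢; linarith
  have log2187 : Real.log 2187 = 7 * Real.log 3 := by
    have := log_two_pow_mul_three_pow_mul_five_pow 0 7 0
    norm_num at this ⊢; linarith
  -- x₀ = 2660 is well above e^(s 4), about 2180, and close to the largest value that log 2H allows;
  -- the logarithmic errors need it.
  refine linear_form_lower_bound K σ hH lam hlam hbound (s := s 4) (d := d 4) (c := d 4)
    (B := B 4) (D := D 4) (γ := 0) (x₀ := 2660)
    (J := fun n => (0.382 - 0.33) * (Real.exp (-0.33) + Real.exp (-(((4 : ℕ) : ℝ) - 0.382))) *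
      (3.63144 ^ n / 0.33) + ((4 : ℕ) : ℝ) ^ 4 * 3.6203 ^ (n - 1))
    (τ := fun n => 2.485 + 1.28964 * n) (by linarith) ?_ le_rfl ?_ ?_ ?_ ?_ ?_ ?_ ?_ ?_ ?_ ?_
  · rw [hd]; norm_num
  · rw [hd]; norm_num; linarith
  · rw [hB]; norm_num
  · rw [hB, hd]; norm_num
  · rw [hB, hd, hD]; norm_num
  · have h1 : s 4 ≤ Real.log 2592 := by rw [log2592]; linarith
    have h2 := (Real.le_log_iff_exp_le (by norm_num)).1 h1
    linarith
  · have h1 := log_two_mul_ge hH hlog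
    have h2 : (2180 : ℝ) ≤ Real.exp (s 4) := by
      have h3 := Real.add_one_le_exp (s 4 - Real.log 2187)
      rw [Real.exp_sub, Real.exp_log (by norm_num), log2187, le_div_iff₀ (by norm_num)] at h3
      linarith
    have h3 : (7.6872 : ℝ) * 2180 ≤ s 4 * Real.exp (s 4) := by gcongr
    have h4 := log_le_log_add (show (0 : ℝ) < 2592 by norm_num) (show (0 : ℝ) < 2660 by norm_num)
    rw [log2592] at h4
    rw [hd]
    linarith
  · intro n hn k hk
    have hn1 : 1 ≤ n := by
      have : (1 : ℝ) ≤ n := by linarith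
      exact_mod_cast this
    refine integral_hermite_le_of_peaks hk hn1 (by norm_num) (by norm_num) (by norm_num)
      (by norm_num) (by norm_num) (fun x h0 h4 => nodeProd_four_le h0 (by exact_mod_cast h4))
      (fun x h0 h1 => nodeProd_four_le_of_edge h0 (by linarith) ?_)
      (fun x h0 h1 => nodeProd_four_le_of_middle ?_)
      (fun x h0 h1 => nodeProd_four_le_of_edge (by push_cast at h0; linarith)
        (by exact_mod_cast h1) ?_)
    · rw [le_abs]; right; linarith
    · rw [abs_le]; push_cast at h1; constructor <;> linarith
    · push_cast at h0
      rw [le_abs]; left; linarith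
  · intro n hn
    refine remainder_four_le ?_
    have : 2660 < n := by exact_mod_cast hn
    exact this
  · intro n hn
    have h1 := log_le_log_add (show (0 : ℝ) < 2592 by norm_num) (show (0 : ℝ) < n by linarith)
    have h2 := log_le_log_add (show (0 : ℝ) < 2592 by norm_num)
      (show (0 : ℝ) < (n : ℝ) + 1 by linarith)
    have h2661 : (2661 : ℝ) ≤ n := by
      have : 2660 < n := by exact_mod_cast hn
      exact_mod_cast this
    rw [log2592] at h1 h2
    rw [primeWeight_four, primeCount_four, hd]
    have h3 := mul_le_mul_of_nonneg_right l2.le (Nat.cast_nonneg (α := ℝ) n)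
    linarith
  · intro n hn
    have h2 := log_le_log_add (show (0 : ℝ) < 2592 by norm_num)
      (show (0 : ℝ) < (n : ℝ) + 1 by linarith)
    rw [log2592] at h2
    rw [primeWeight_four, primeCount_four, hd, hB]
    rw [show (((4 : ℕ) : ℝ) + 1) = 5 by norm_num]
    have h3 := mul_le_mul_of_nonneg_right l5'.le (Nat.cast_nonneg (α := ℝ) n)
    have h4 := mul_le_mul_of_nonneg_right l2.le (Nat.cast_nonneg (α := ℝ) n)
    push_cast
    linarith

end SmallDegrees

end ExpMeasure

end

/-! ### Uniform estimates for m ≥ 5 -/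

noncomputable section

namespace ExpMeasure

/-- Passing from m to m + 1 costs a factor at most m + 1: for x ≤ 1 the last node is dropped, for x
≥ 1 the node 0 is dropped and x is shifted by 1. The constant is the peak bound at m = 5 divided by
5!. -/
theorem nodeProd_le_mul_factorial {m : ℕ} (hm : 5 ≤ m) :
    ∀ x : ℝ, 0 ≤ x → x ≤ m → nodeProd m x ≤ 16.902 / 120 * m.factorial := by
  induction m, hm using Nat.le_induction with
  | base =>
    intro x h0 h5
    have := nodeProd_five_le h0 (by exact_mod_cast h5)
    norm_num [Nat.factorial] at this ⊢
    exact this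
  | succ m hm ih =>
    intro x h0 h1
    have hm5 : (5 : ℝ) ≤ m := by exact_mod_cast hm
    have hfac : ((m + 1).factorial : ℝ) = (m + 1) * m.factorial := by
      rw [Nat.factorial_succ]; push_cast; ring
    push_cast at h1
    rw [hfac]
    rcases le_total x 1 with hx | hx
    · have h2 : nodeProd (m + 1) x = nodeProd m x * |x - (m + 1 : ℕ)| := by
        rw [nodeProd, Finset.prod_range_succ, nodeProd]
      have h3 : |x - (m + 1 : ℕ)| ≤ m + 1 := by
        push_cast; rw [abs_le]; constructor <;> linarith
      rw [h2]
      calc _ ≤ 16.902 / 120 * (m.factorial : ℝ) * (m + 1) :=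
            mul_le_mul (ih x h0 (by linarith)) h3 (abs_nonneg _) (by positivity)
        _ = _ := by ring
    · have h2 : nodeProd (m + 1) x = nodeProd m (x - 1) * |x| := by
        rw [nodeProd, Finset.prod_range_succ', nodeProd]
        congr 1
        · refine Finset.prod_congr rfl fun i _ => ?_
          congr 1
          push_cast
          ring
        · simp
      have h3 : |x| ≤ m + 1 := by rw [abs_le]; constructor <;> linarith
      rw [h2]
      calc _ ≤ 16.902 / 120 * (m.factorial : ℝ) * (m + 1) :=
            mul_le_mul (ih (x - 1) (by linarith) (by linarith)) h3 (abs_nonneg _) (by positivity)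
        _ = _ := by ring

theorem sum_exp_le (m : ℕ) : ∑ j ∈ Finset.range m, Real.exp ((j : ℝ) + 1) ≤ 2 * Real.exp m := by
  induction m with
  | zero => simp
  | succ m ih =>
    rw [Finset.sum_range_succ]
    have h1 := Real.exp_one_gt_two
    have h2 : Real.exp ((m + 1 : ℕ) : ℝ) = Real.exp m * Real.exp 1 := by
      rw [← Real.exp_add]; push_cast; rfl
    have h3 : Real.exp ((m : ℝ) + 1) = Real.exp m * Real.exp 1 := Real.exp_add _ _
    rw [h2, h3]
    nlinarith [Real.exp_pos (m : ℝ)]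

theorem two_le_of_mem_smallPrimes {m p : ℕ} (hp : p ∈ smallPrimes m) : 2 ≤ p :=
  (prime_of_mem_smallPrimes hp).two_le

theorem two_mul_le_of_mem_smallPrimes {m p : ℕ} (hp : p ∈ smallPrimes m) : 2 * p ≤ m + 1 :=
  (Finset.mem_filter.1 hp).2.2

theorem minFloor_le_div (m p : ℕ) : minFloor m p ≤ m / p := by
  simpa using minFloor_le p (Nat.zero_le m)

theorem minFloor_le_half {m p : ℕ} (hp : 2 ≤ p) : (minFloor m p : ℝ) ≤ m / 2 := by
  have h1 : minFloor m p ≤ m / 2 :=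
    (minFloor_le_div m p).trans (Nat.div_le_div_left hp (by norm_num))
  calc (minFloor m p : ℝ) ≤ ((m / 2 : ℕ) : ℝ) := by exact_mod_cast h1
    _ ≤ (m : ℝ) / (2 : ℕ) := Nat.cast_div_le
    _ = _ := by norm_num

theorem primeCount_le {m : ℕ} (hm : 1 ≤ m) : primeCount m ≤ m * (m - 1) / 4 := by
  have hm' : (1 : ℝ) ≤ m := by exact_mod_cast hm
  have hcard : 2 * (smallPrimes m).card ≤ m - 1 := by
    have hsub : smallPrimes m ⊆ Finset.Ico 2 ((m + 1) / 2 + 1) := fun p hp => by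
      have h1 := two_le_of_mem_smallPrimes hp
      have h2 := two_mul_le_of_mem_smallPrimes hp
      exact Finset.mem_Ico.2 ⟨h1, by omega⟩
    have h := Finset.card_le_card hsub
    rw [Nat.card_Ico] at h
    omega
  have hcard' : 2 * ((smallPrimes m).card : ℝ) ≤ m - 1 := by
    have : (2 * (smallPrimes m).card : ℕ) ≤ ((m - 1 : ℕ) : ℝ) := by exact_mod_cast hcard
    rw [Nat.cast_sub hm] at this
    push_cast at this
    exact this
  calc primeCount m ≤ ∑ _p ∈ smallPrimes m, (m : ℝ) / 2 :=
        Finset.sum_le_sum fun p hp => minFloor_le_half (two_le_of_mem_smallPrimes hp)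
    _ = (smallPrimes m).card * ((m : ℝ) / 2) := by rw [Finset.sum_const, nsmul_eq_mul]
    _ ≤ (((m : ℝ) - 1) / 2) * ((m : ℝ) / 2) := by gcongr; linarith
    _ = _ := by ring

theorem pow_minFloor_dvd_factorial {m p : ℕ} (hp : p.Prime) :
    p ^ minFloor m p ∣ m.factorial := by
  have : Fact p.Prime := ⟨hp⟩
  refine (pow_dvd_pow p (minFloor_le_div m p)).trans ?_
  refine dvd_trans ?_ (Nat.factorial_dvd_factorial (Nat.mul_div_le m p))
  rw [padicValNat_dvd_iff_le (Nat.factorial_ne_zero _), padicValNat_factorial_mul]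
  exact Nat.le_add_left _ _

/-- The powers p^`minFloor m p` are pairwise coprime and each divides m!, hence so does their
product. -/
theorem sum_minFloor_mul_log_le (m : ℕ) :
    ∑ p ∈ smallPrimes m, (minFloor m p : ℝ) * Real.log p ≤ Real.log m.factorial := by
  have hdvd : ∏ p ∈ smallPrimes m, p ^ minFloor m p ∣ m.factorial := by
    refine Finset.prod_dvd_of_isRelPrime ?_ fun p hp =>
      pow_minFloor_dvd_factorial (prime_of_mem_smallPrimes hp)
    intro p hp q hq hpq
    exact Nat.coprime_iff_isRelPrime.1 (Nat.Coprime.pow _ _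
      ((Nat.coprime_primes (prime_of_mem_smallPrimes hp) (prime_of_mem_smallPrimes hq)).2 hpq))
  have hle := Nat.le_of_dvd (Nat.factorial_pos m) hdvd
  have hpos : ∀ p ∈ smallPrimes m, ((p : ℝ) ^ minFloor m p) ≠ 0 := fun p hp =>
    pow_ne_zero _ (Nat.cast_ne_zero.2 (prime_of_mem_smallPrimes hp).ne_zero)
  have hle' : ∏ p ∈ smallPrimes m, (p : ℝ) ^ minFloor m p ≤ m.factorial := by exact_mod_cast hle
  have hprod : 0 < ∏ p ∈ smallPrimes m, (p : ℝ) ^ minFloor m p :=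
    Finset.prod_pos fun p hp =>
      pow_pos (Nat.cast_pos.2 (prime_of_mem_smallPrimes hp).pos) _
  have h := Real.log_le_log hprod hle'
  rw [Real.log_prod hpos] at h
  simpa only [Real.log_pow] using h

/-- For p ≥ 3 one has 1/(p - 1) ≤ 1/2; the prime 2 needs an additional half of its own term, at most
(m/4) log 2. -/
theorem primeWeight_le (m : ℕ) :
    primeWeight m ≤ Real.log m.factorial / 2 + m / 4 * Real.log 2 := by
  have hterm : ∀ p ∈ smallPrimes m,
      (minFloor m p : ℝ) * (Real.log p / ((p : ℝ) - 1)) ≤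
        (minFloor m p : ℝ) * Real.log p / 2 + if p = 2 then (m : ℝ) / 4 * Real.log 2 else 0 := by
    intro p hp
    have h2 := two_le_of_mem_smallPrimes hp
    have hlog : 0 ≤ Real.log p := Real.log_natCast_nonneg p
    split_ifs with h
    · subst h
      have h3 := minFloor_le_half (m := m) (le_refl 2)
      have h4 := Real.log_two_gt_d9
      norm_num
      nlinarith
    · have h3 : (3 : ℝ) ≤ p := by exact_mod_cast (show 3 ≤ p by omega)
      have h4 : Real.log p / ((p : ℝ) - 1) ≤ Real.log p / 2 := by gcongr; linarith
      rw [add_zero, mul_div_assoc]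
      gcongr
  have h5 := Real.log_two_gt_d9
  calc primeWeight m ≤ _ := Finset.sum_le_sum hterm
    _ = (∑ p ∈ smallPrimes m, (minFloor m p : ℝ) * Real.log p) / 2 +
        if 2 ∈ smallPrimes m then (m : ℝ) / 4 * Real.log 2 else 0 := by
        rw [Finset.sum_add_distrib, Finset.sum_div, Finset.sum_ite_eq']
    _ ≤ _ := by
        have h6 := sum_minFloor_mul_log_le m
        have h7 : (if 2 ∈ smallPrimes m then (m : ℝ) / 4 * Real.log 2 else 0) ≤
            m / 4 * Real.log 2 := by
          split_ifs
          · exact le_rfl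
          · positivity
        linarith

theorem kappa_mul {m : ℕ} (hm : 1 ≤ m) :
    kappa m * m = ∑ p ∈ smallPrimes m, (minFloor m p : ℝ) * (Real.log p / ((p : ℝ) - 1)) *
      w p (s m * Real.exp (s m)) := by
  have : (m : ℝ) ≠ 0 := by positivity
  rw [kappa, smallPrimes, mul_comm, ← mul_assoc, mul_one_div_cancel this, one_mul]

theorem w_le_one {p : ℕ} (hp : 2 ≤ p) {x : ℝ} (hx : 1 ≤ x) : w p x ≤ 1 := by
  have hp' : (2 : ℝ) ≤ p := by exact_mod_cast hp
  have h1 : 0 ≤ (p : ℝ) / x := by positivity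
  have h2 : 0 ≤ ((p : ℝ) - 1) / Real.log p :=
    div_nonneg (by linarith) (Real.log_natCast_nonneg p)
  have h3 : 0 ≤ Real.log x / x := div_nonneg (Real.log_nonneg hx) (by linarith)
  have h4 := mul_nonneg h2 h3
  rw [w]
  linarith

theorem w_nonneg {p : ℕ} (hp : 2 ≤ p) {s : ℝ} (hs : 12 ≤ s) (hps : (p : ℝ) ≤ s) :
    0 ≤ w p (s * Real.exp s) := by
  have hp' : (2 : ℝ) ≤ p := by exact_mod_cast hp
  have he := Real.exp_pos s
  have hx : 0 < s * Real.exp s := by positivity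
  have h1 : (p : ℝ) / (s * Real.exp s) ≤ 1 / Real.exp s := by
    rw [div_le_div_iff₀ hx he]
    nlinarith
  have hlog2 := Real.log_two_gt_d9
  have hlogp : Real.log 2 ≤ Real.log p := Real.log_le_log two_pos hp'
  have h2 : ((p : ℝ) - 1) / Real.log p ≤ 2 * s := by
    rw [div_le_iff₀ (by linarith)]
    nlinarith
  have h3 : Real.log (s * Real.exp s) / (s * Real.exp s) ≤ 2 / Real.exp s := by
    rw [Real.log_mul (by linarith) he.ne', Real.log_exp, div_le_div_iff₀ hx he]
    have h4 := Real.log_le_sub_one_of_pos (show 0 < s by linarith)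
    nlinarith
  have h3' : 0 ≤ Real.log (s * Real.exp s) / (s * Real.exp s) := by
    refine div_nonneg (Real.log_nonneg ?_) hx.le
    have := Real.add_one_le_exp s
    nlinarith
  have h5 : ((p : ℝ) - 1) / Real.log p * (Real.log (s * Real.exp s) / (s * Real.exp s)) ≤
      2 * s * (2 / Real.exp s) := mul_le_mul h2 h3 h3' (by linarith)
  have h6 : 1 / Real.exp s + 2 * s * (2 / Real.exp s) ≤ 1 := by
    have h7 := Real.quadratic_le_exp_of_nonneg (show 0 ≤ s by linarith)
    rw [show 1 / Real.exp s + 2 * s * (2 / Real.exp s) = (1 + 4 * s) / Real.exp s by ring,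
      div_le_one he]
    nlinarith
  rw [w]
  linarith

section LargeDegrees

variable {m : ℕ}

theorem log_ge_of_five_le (hm : 5 ≤ m) : 1.6094 ≤ Real.log m := by
  have h := Real.log_le_log (by norm_num) (show (5 : ℝ) ≤ m by exact_mod_cast hm)
  linarith [Real.log_five_gt_d9]

theorem s_eq_of_five_le (hm : 5 ≤ m) : s m = m * Real.log m ^ 2 := by
  rw [s, if_neg (by omega)]

theorem s_ge_of_five_le (hm : 5 ≤ m) : 12.95 ≤ s m ∧ 2.59 * m ≤ s m ∧
    1.609 * (m * Real.log m) ≤ s m := by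
  have h1 : (1.6094379123 : ℝ) ≤ Real.log m := by
    have h := Real.log_le_log (by norm_num) (show (5 : ℝ) ≤ m by exact_mod_cast hm)
    linarith [Real.log_five_gt_d9]
  have h2 : (5 : ℝ) ≤ m := by exact_mod_cast hm
  have h3 : (2.59 : ℝ) ≤ Real.log m ^ 2 := by nlinarith
  have h3' : (2.590001 : ℝ) ≤ Real.log m ^ 2 := by nlinarith
  have h4 : 2.59 * (m : ℝ) ≤ m * Real.log m ^ 2 := by
    rw [mul_comm]; gcongr
  rw [s_eq_of_five_le hm]
  refine ⟨by nlinarith, h4, ?_⟩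
  have h5 : 1.609 * Real.log m ≤ Real.log m ^ 2 := by nlinarith
  calc 1.609 * (m * Real.log m) = m * (1.609 * Real.log m) := by ring
    _ ≤ _ := by gcongr

/-- Each weight w is at most 1, so the divisor actually gains at least as much as κ_m records. -/
theorem kappa_mul_le (hm : 5 ≤ m) : kappa m * m ≤ primeWeight m := by
  obtain ⟨hs, _, _⟩ := s_ge_of_five_le hm
  rw [kappa_mul (by omega), primeWeight]
  refine Finset.sum_le_sum fun p hp => ?_
  have h2 := two_le_of_mem_smallPrimes hp
  have h2' : (2 : ℝ) ≤ p := by exact_mod_cast h2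
  refine mul_le_of_le_one_right (mul_nonneg (Nat.cast_nonneg _)
    (div_nonneg (Real.log_natCast_nonneg p) (by linarith))) (w_le_one h2 ?_)
  have := Real.add_one_le_exp (s m)
  nlinarith

theorem kappa_mul_nonneg (hm : 5 ≤ m) : 0 ≤ kappa m * m := by
  obtain ⟨hs, hs2, _⟩ := s_ge_of_five_le hm
  rw [kappa_mul (by omega)]
  refine Finset.sum_nonneg fun p hp => ?_
  have h2 := two_le_of_mem_smallPrimes hp
  have h2' : (2 : ℝ) ≤ p := by exact_mod_cast h2
  have h3 : (p : ℝ) ≤ m := by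
    have := two_mul_le_of_mem_smallPrimes hp
    exact_mod_cast (show p ≤ m by omega)
  have h4 : (0 : ℝ) ≤ m := Nat.cast_nonneg m
  exact mul_nonneg (mul_nonneg (Nat.cast_nonneg _)
    (div_nonneg (Real.log_natCast_nonneg p) (by linarith)))
    (w_nonneg h2 (by linarith) (by linarith))

theorem log_factorial_le_of_five_le (hm : 5 ≤ m) :
    Real.log m.factorial ≤ m * Real.log m - m + Real.log m / 2 +
      (Real.log 120 - (5 * Real.log 5 - 5 + Real.log 5 / 2)) := by
  have := log_factorial_le_of_le (a := 5) (by norm_num) hm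
  norm_num [Nat.factorial] at this ⊢
  exact this

theorem log_one_twenty : Real.log 120 = 3 * Real.log 2 + Real.log 3 + Real.log 5 := by
  rw [show (120 : ℝ) = 2 ^ 3 * 3 * 5 by norm_num, Real.log_mul (by norm_num) (by norm_num),
    Real.log_mul (by norm_num) (by norm_num), Real.log_pow]
  norm_num

theorem log_peak_five_le : Real.log 16.902 ≤ 2.827434 := by
  have l2 := Real.log_two_gt_d9
  have l3 := Real.log_three_lt_d9
  have l5 := Real.log_five_lt_d9
  have h := Real.log_le_sub_one_of_pos (show (0 : ℝ) < 16.902 / 16.875 by norm_num)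
  rw [Real.log_div (by norm_num) (by norm_num), show (16.875 : ℝ) = 3 ^ 3 * 5 / 2 ^ 3 by norm_num,
    Real.log_div (by norm_num) (by norm_num), Real.log_mul (by norm_num) (by norm_num),
    Real.log_pow, Real.log_pow] at h
  norm_num at h ⊢
  linarith

theorem primeWeight_le_of_five_le (hm : 5 ≤ m) :
    primeWeight m ≤ m * Real.log m / 2 + Real.log m / 4 - 0.3267 * m + 0.5 := by
  have h1 := primeWeight_le m
  have h2 := log_factorial_le_of_five_le hm
  rw [log_one_twenty] at h2
  have l2 := Real.log_two_lt_d9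
  have l3 := Real.log_three_lt_d9
  have l5 := Real.log_five_gt_d9
  have h3 : (m : ℝ) / 4 * Real.log 2 ≤ m / 4 * 0.6931471808 := by gcongr
  have h4 : (0 : ℝ) ≤ m := Nat.cast_nonneg m
  linarith

/-- From e^(L/12) ≥ e L/12 ≥ 0.2265 L, raised to the 12th power: nine factors, each at least 2.93,
supply the constant and three supply L³. -/
theorem mul_cube_le_exp {L : ℝ} (hL : 12.95 ≤ L) : 160 * L ^ 3 ≤ Real.exp L := by
  have h1 : 0.2265 * L ≤ Real.exp (L / 12) := by
    have h2 := Real.add_one_le_exp (L / 12 - 1)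
    rw [Real.exp_sub, le_div_iff₀ (Real.exp_pos 1)] at h2
    have h3 := Real.exp_one_gt_d9
    nlinarith
  have h4 : Real.exp L = Real.exp (L / 12) ^ 12 := by
    rw [← Real.exp_nat_mul]; congr 1; push_cast; ring
  have h5 : (2.93 : ℝ) ≤ 0.2265 * L := by linarith
  have h6 : (2.93 : ℝ) ^ 9 ≤ (0.2265 * L) ^ 9 := by gcongr
  have h7 : (0 : ℝ) ≤ L ^ 3 := by positivity
  have h8 : (160 : ℝ) ≤ 2.93 ^ 9 * 0.2265 ^ 3 := by norm_num
  calc 160 * L ^ 3 ≤ 2.93 ^ 9 * 0.2265 ^ 3 * L ^ 3 := by gcongr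
    _ = 2.93 ^ 9 * (0.2265 * L) ^ 3 := by ring
    _ ≤ (0.2265 * L) ^ 9 * (0.2265 * L) ^ 3 := by gcongr
    _ = (0.2265 * L) ^ 12 := by ring
    _ ≤ Real.exp (L / 12) ^ 12 := by gcongr
    _ = _ := h4.symm

/-- With L = log n ≥ s m, both m and m log m are O(L) and `primeCount m` is O(L²), so everything is
O(L³) against n = e^L. -/
theorem log_terms_le (hm : 5 ≤ m) {n : ℕ} (hn : Real.exp (s m) < n) :
    1 + m + m * Real.log m + Real.log n / 2 + primeCount m * Real.log (n + 1) ≤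
      0.00033 * n := by
  obtain ⟨hs, hs2, hs3⟩ := s_ge_of_five_le hm
  have hn0 : (0 : ℝ) < n := (Real.exp_pos _).trans hn
  have hL : s m ≤ Real.log n := (Real.le_log_iff_exp_le hn0).2 hn.le
  set L := Real.log n with hLdef
  have hL1 : 12.95 ≤ L := hs.trans hL
  have hexp : Real.exp L = n := Real.exp_log hn0
  have h1 := mul_cube_le_exp hL1
  rw [hexp] at h1
  have hm5 : (5 : ℝ) ≤ m := by exact_mod_cast hm
  have hn100 : (100 : ℝ) ≤ n := by
    have : (12.95 : ℝ) ^ 3 ≤ L ^ 3 := by gcongr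
    norm_num at this
    linarith
  have h2 : Real.log (n + 1) ≤ L + 0.01 := by
    have h3 := Real.log_le_sub_one_of_pos (show (0 : ℝ) < (n + 1) / n by positivity)
    rw [Real.log_div (by positivity) hn0.ne', add_div, div_self hn0.ne'] at h3
    have h4 : 1 / (n : ℝ) ≤ 1 / 100 := by gcongr
    linarith
  have hC := primeCount_le (m := m) (by omega)
  have hmL : (m : ℝ) ≤ 0.3862 * L := by linarith
  have hC2 : primeCount m ≤ 0.0373 * L ^ 2 := by
    refine hC.trans ?_
    have : (m : ℝ) * (m - 1) ≤ (0.3862 * L) * (0.3862 * L) :=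
      mul_le_mul hmL (by linarith) (by linarith) (by linarith)
    nlinarith
  have h5 : primeCount m * Real.log (n + 1) ≤ 0.0373 * L ^ 2 * (L + 0.01) :=
    mul_le_mul hC2 h2 (Real.log_nonneg (by linarith)) (by positivity)
  have hmlog : (m : ℝ) * Real.log m ≤ 0.6216 * L := by linarith
  have hsq : 12.95 * L ≤ L ^ 2 := by nlinarith
  have hcube : 12.95 * L ^ 2 ≤ L ^ 3 := by nlinarith
  nlinarith

end LargeDegrees

end ExpMeasure

end

/-! ### The lower bound for m ≥ 5 and the final case distinction -/

noncomputable section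

namespace ExpMeasure

theorem linear_form_bound_large (K : Type*) [Field K] [NumberField K]
    [Algebra.IsQuadraticExtension ℚ K] [NumberField.IsTotallyComplex K] (σ : K →+* ℂ)
    {m : ℕ} (hm : 5 ≤ m) {H : ℝ} (hH : 0 < H)
    (hlog : s m * Real.exp (s m) ≤ Real.log H) (lam : Fin (m + 1) → NumberField.RingOfIntegers K)
    (hlam : lam ≠ 0) (hbound : ∀ j : Fin (m + 1), 1 ≤ (j : ℕ) → ‖σ (lam j : K)‖ ≤ H) :
    1 / (2 * Real.exp (D m)) * ((s m - d m) / (s m + Real.log (s m)) *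
        (Real.log (Real.log (2 * H)) / Real.log (2 * H))) ^ m *
        (2 * H) ^ (-(m : ℝ) - Bhat m / Real.log (Real.log (2 * H))) ≤
      ‖∑ j : Fin (m + 1), σ (lam j : K) * Complex.exp 1 ^ (j : ℕ)‖ := by
  obtain ⟨hs, hs2, hs3⟩ := s_ge_of_five_le hm
  have hm5 : (5 : ℝ) ≤ m := by exact_mod_cast hm
  have hℓ := log_ge_of_five_le hm
  have hκ0 := kappa_mul_nonneg hm
  have hκ1 := kappa_mul_le hm
  have hW := primeWeight_le_of_five_le hm
  have e1' := Real.exp_one_lt_d9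
  have hmℓ : 1.6094 * (m : ℝ) ≤ m * Real.log m := by rw [mul_comm]; gcongr
  have hlogm1 : Real.log m ≤ Real.log ((m : ℝ) + 1) :=
    Real.log_le_log (by linarith) (by linarith)
  have hm1log : (m + 1) * Real.log m ≤ ((m : ℝ) + 1) * Real.log ((m : ℝ) + 1) := by gcongr
  have hd : d m = (m : ℝ) * Real.log m + Real.log m / 2 - m - kappa m * m - 0.02394 := by
    rw [d, if_neg (by omega), if_neg (by omega), if_neg (by omega)]
    ring
  have hBd : B m - m * d m =
      ((m : ℝ) + 1) * Real.log ((m : ℝ) + 1) - m - kappa m * m + 0.0000525 := by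
    rw [hd, B, if_neg (by omega), if_neg (by omega), if_neg (by omega)]
    ring
  have hD : D m = ((m : ℝ) + 1) * Real.log ((m : ℝ) + 1) - kappa m * m + 0.0000525 +
      m / Real.exp (s m) := by
    rw [D, if_neg (by omega), if_neg (by omega), if_neg (by omega)]
  have hd0 : 0.3 ≤ d m := by rw [hd]; linarith
  have hβ : 0 ≤ B m - m * d m := by rw [hBd]; linarith
  have hmd : 0 ≤ m * d m := mul_nonneg (by linarith) (by linarith)
  have hmc : B m - m * (d m - 0.0002) = B m - m * d m + 0.0002 * m := by ring
  -- Lowering c by 0.0002 raises B - m c by 0.0002 m ≥ 0.001, enough for the 0.00033 n of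
  -- `log_terms_le` and for γ; this γ makes the condition on D an equality.
  refine linear_form_lower_bound K σ hH lam hlam hbound (s := s m) (d := d m)
    (c := d m - 0.0002) (B := B m) (D := D m) (γ := 0.0002 * m) (x₀ := Real.exp (s m))
    (J := fun n => (m : ℝ) ^ m * (16.902 / 120 * m.factorial) ^ (n - 1))
    (τ := fun n => 1 + m + m * Real.log m + n * Real.log (16.902 / 120 * m.factorial))
    (by linarith) (by linarith) (by linarith) ?_ ?_ ?_ ?_ le_rfl ?_ ?_ ?_ ?_ ?_
  · rw [hd, s_eq_of_five_le hm]
    have h1 : 1.6094 * (m * Real.log m) ≤ m * Real.log m ^ 2 := by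
      calc 1.6094 * (m * Real.log m) = m * Real.log m * 1.6094 := by ring
        _ ≤ m * Real.log m * Real.log m := by gcongr
        _ = _ := by ring
    have h2 : 5 * Real.log m ≤ m * Real.log m := by gcongr
    linarith
  · linarith
  · rw [hmc]; linarith
  · rw [hmc, hBd, hD]; linarith
  · rw [Real.log_exp]
    have h1 := log_two_mul_ge hH hlog
    have h2 := Real.exp_pos (s m)
    nlinarith
  · intro n hn k hk
    have hn1 : 1 ≤ n := by
      have : (0 : ℝ) < n := (Real.exp_pos _).trans hn
      exact_mod_cast this
    exact integral_hermite_le hk hn1 (by positivity) (nodeProd_le_mul_factorial hm)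
  · intro n hn
    have hM1 : (1 : ℝ) ≤ 16.902 / 120 * m.factorial := by
      have h1 : (120 : ℝ) ≤ m.factorial := by
        exact_mod_cast (show 120 ≤ m.factorial from
          (by decide : 120 ≤ Nat.factorial 5).trans (Nat.factorial_le hm))
      linarith
    have h2 : (16.902 / 120 * m.factorial : ℝ) ^ (n - 1) ≤
        Real.exp (n * Real.log (16.902 / 120 * m.factorial)) := by
      rw [Real.exp_nat_mul, Real.exp_log (by linarith)]
      exact pow_le_pow_right₀ hM1 (Nat.sub_le n 1)
    have h3 : (m : ℝ) ^ m = Real.exp (m * Real.log m) := by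
      rw [Real.exp_nat_mul, Real.exp_log (by linarith)]
    have h4 : (2 : ℝ) ≤ Real.exp 1 := Real.exp_one_gt_two.le
    rw [Real.exp_add, Real.exp_add, Real.exp_add, h3, mul_assoc (_ * _)]
    refine mul_le_mul ((sum_exp_le m).trans ?_) ?_ (by positivity) (by positivity)
    · gcongr
    · gcongr
  · intro n hn
    have h1 := log_terms_le hm hn
    have hn0 : (0 : ℝ) < n := (Real.exp_pos _).trans hn
    -- The constant is log 16.902 + 5 - (11/2) log 5, rounded. Its distance from 0.02394 + 1 +
    -- 0.0002 just covers the 0.00033 n of logarithmic terms.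
    have h2 : Real.log (16.902 / 120 * m.factorial) ≤
        m * Real.log m - m + Real.log m / 2 - 1.0244745 := by
      rw [Real.log_mul (by norm_num) (by positivity), Real.log_div (by norm_num) (by norm_num)]
      have h3 := log_factorial_le_of_five_le hm
      have h4 := log_peak_five_le
      have h5 := Real.log_five_gt_d9
      linarith
    have h3 : (n : ℝ) * Real.log (16.902 / 120 * m.factorial) ≤
        n * (m * Real.log m - m + Real.log m / 2 - 1.0244745) := by gcongr
    have h4 : (n : ℝ) * (m * Real.log m + Real.log m / 2 - m - 1.02414) ≤
        (d m - 0.0002 - 1 + primeWeight m) * n := by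
      rw [mul_comm]
      gcongr
      rw [hd]
      linarith
    linarith
  · intro n hn
    have h1 := log_terms_le hm hn
    have hn0 : (0 : ℝ) < n := (Real.exp_pos _).trans hn
    have hn1 : (1 : ℝ) ≤ n := by
      have : 0 < n := by exact_mod_cast hn0
      exact_mod_cast this
    rw [hmc, hBd]
    have h2 : (((m : ℝ) + 1) * Real.log (m + 1) - m - primeWeight m) * n ≤
        (((m : ℝ) + 1) * Real.log (m + 1) - m - kappa m * m) * n := by gcongr
    have h3 : 5 * (n : ℝ) ≤ m * n := by gcongr
    have h4 : 0 ≤ Real.log n := Real.log_nonneg hn1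
    linarith

end ExpMeasure

end

theorem corollary2p2
    (K : Type*) [Field K] [NumberField K] [Algebra.IsQuadraticExtension ℚ K]
    [NumberField.IsTotallyComplex K] (σ : K →+* ℂ)
    (m : ℕ) (hm : 2 ≤ m)
    (H : ℝ) (hHpos : 0 < H)
    (hH : ExpMeasure.s m * Real.exp (ExpMeasure.s m) ≤ Real.log H)
    (lam : Fin (m + 1) → NumberField.RingOfIntegers K) (hlam : lam ≠ 0)
    (hbound : ∀ j : Fin (m + 1), 1 ≤ (j : ℕ) → ‖σ (lam j : K)‖ ≤ H) :
    1 / (2 * Real.exp (ExpMeasure.D m)) *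
        ((ExpMeasure.s m - ExpMeasure.d m) /
            (ExpMeasure.s m + Real.log (ExpMeasure.s m)) *
          (Real.log (Real.log (2 * H)) / Real.log (2 * H))) ^ m *
        (2 * H) ^ (-(m : ℝ) - ExpMeasure.Bhat m / Real.log (Real.log (2 * H))) ≤
      ‖∑ j : Fin (m + 1), σ (lam j : K) * Complex.exp 1 ^ (j : ℕ)‖ := by
  obtain rfl | rfl | rfl | h5 : m = 2 ∨ m = 3 ∨ m = 4 ∨ 5 ≤ m := by omega
  · exact ExpMeasure.linear_form_bound_two K σ hHpos hH lam hlam hbound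
  · exact ExpMeasure.linear_form_bound_three K σ hHpos hH lam hlam hbound
  · exact ExpMeasure.linear_form_bound_four K σ hHpos hH lam hlam hbound
  · exact ExpMeasure.linear_form_bound_large K σ h5 hHpos hH lam hlam hbound
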